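/- **Setting.** Let $G$ be a finite abelian group (written additively) and $\hat G$ its group of characters. Let $E$ be a CW complex with set of $k$-cells $\mathcal E_k$ ($k\ge 0$, and $\mathcal E_{-1}=\emptyset$), all cells being oriented. For $\alpha\in\mathcal E_{k+1}$, $\beta\in\mathcal E_k$ let $d_{\alpha\beta}\in\mathbb Z$ be the incidence number, i.e. the degree of the composite $S^k\to E^k\to S^k$ of the attaching map of $\alpha$ with the map collapsing the complement of the open cell $\beta$ to a point (with sign according to the orientations). Assume that for every $k$ and every $\beta\in\mathcal E_k$ only finitely many $\alpha\in\mathcal E_{k+1}$ have $d_{\alpha\beta}\neq 0$. For an abelian group $A$, the boundary map $\partial$ takes locally finite (i.e. arbitrary) families $c\in\prod_{\mathcal E_{k+1}}A$ to $(\partial c)_\beta=\sum_\alpha d_{\alpha\beta}c_\alpha$, and the coboundary map $\partial^T$ takes $c\in\prod_{\mathcal E_k}A$ to $(\partial^Tc)_\alpha=\sum_\beta d_{\alpha\beta}c_\beta$; both preserve finite support. On $\mathcal E_0$, $\partial=0$. Locally finite $k$-chains are elements of $\prod_{\mathcal E_k}\hat G$, $k$-cochains are elements of $\prod_{\mathcal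 E_k}G$. Fix $n\ge 0$. *Classes at infinity.* Let $\gamma,\gamma'$ be locally finite $n$-chains with $\partial\gamma,\partial\gamma'$ finitely supported. They define the same class in $H^\infty_{n-1}(E;\hat G)$ if $(-\partial\gamma,\gamma)-(-\partial\gamma',\gamma')=(-\partial a,\ a+\partial c)$ for some finitely supported $n$-chain $a$ and some locally finite $(n+1)$-chain $c$. Similarly $n$-cochains $\delta,\delta'$ with finitely supported coboundaries define the same class in $H^n_\infty(E;G)$ if $(-\partial^T\delta,\delta)-(-\partial^T\delta',\delta')=(-\partial^Ta,\ a+\partial^Tc)$ for some finitely supported $n$-cochain $a$ and some $(n-1)$-cochain $c$. *The model.* Let $\mathfrak A$ be the quasi-local C*-algebra with Hilbert space $\ell^2(G)$ at each site $\sigma\in\mathcal E_n$. On $\ell^2(G)$ put $X^g|h\rangle=|g+h\rangle$ and $Z^\chi|h\rangle=\chi(h)|h\rangle$; for a finitely supported $a\in\bigoplus_{\mathcal E_n}G$ let $X^a\in\mathfrak A$ be the product of the operators $X^{a_\sigma}$ at the sites $\sigma$, and for $b\in\bigoplus_{\mathcal E_n}\hat G$ define $Z^b$ likewise. Put $$A_\alpha=\frac1{|G|}\sum_{g\in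 G}X^{\partial^T(g e_\alpha)}\quad(\alpha\in\mathcal E_{n-1}),\qquad B_\beta=\frac1{|G|}\sum_{\chi\in\hat G}Z^{\partial(\chi e_\beta)}\quad(\beta\in\mathcal E_{n+1}).$$ A state $\omega_0$ of $\mathfrak A$ is a frustration free ground state if it minimises every interaction term $-A_\alpha$, $-B_\beta$, i.e. $\omega_0(A_\alpha)=1$ and $\omega_0(B_\beta)=1$ for all $\alpha\in\mathcal E_{n-1}$ and $\beta\in\mathcal E_{n+1}$. For a locally finite $n$-chain $\gamma$ and an $n$-cochain $\delta$ let $\gamma_K,\delta_K$ be their restrictions to a finite set $K\subseteq\mathcal E_n$, and define the endomorphisms of $\mathfrak A$ $$\rho_\gamma(A)=\lim_{K}Z^{\gamma_K}AZ^{-\gamma_K},\qquad \rho_\delta(A)=\lim_{K}X^{\delta_K}AX^{-\delta_K},\qquad \rho_{(\gamma,\delta)}=\rho_\gamma\circ\rho_\delta,$$ the limits being norm limits along the directed set of finite subsets $K$ of $\mathcal E_n$. **Proposition.** Let $\omega_0$ be a frustration free ground state, let $\gamma,\gamma'$ be locally finite $n$-chains with finite boundary and let $\delta,\delta'$ be $n$-cochains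 with finite coboundary. If $\gamma,\gamma'$ define the same class in $H^\infty_{n-1}(E;\hat G)$ and $\delta,\delta'$ define the same class in $H^n_\infty(E;G)$, then the GNS representations of the states $\omega_0\circ\rho_{(\gamma,\delta)}$ and $\omega_0\circ\rho_{(\gamma',\delta')}$ are unitarily equivalent. -/

import Mathlib

namespace CellKitaev

noncomputable section CellularDegrees

open Topology Topology.CWComplex Metric CategoryTheory AlgebraicTopology

/-- The singular homology group `H_k(Y; ℤ)`. -/
abbrev singH (k : ℕ) (Y : Type) [TopologicalSpace Y] : ModuleCat.{0} ℤ :=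
  ((singularHomologyFunctor (ModuleCat.{0} ℤ) k).obj (ModuleCat.of ℤ ℤ)).obj (TopCat.of Y)

/-- The map `f_* : H_k(Y; ℤ) → H_k(Z; ℤ)` induced by a continuous map `f`. -/
def singHMap (k : ℕ) {Y Z : Type} [TopologicalSpace Y] [TopologicalSpace Z] (f : C(Y, Z)) :
    singH k Y →ₗ[ℤ] singH k Z :=
  (((singularHomologyFunctor (ModuleCat.{0} ℤ) k).obj (ModuleCat.of ℤ ℤ)).map
    (TopCat.ofHom f)).hom

theorem singHMap_comp (k : ℕ) {Y Z W : Type} [TopologicalSpace Y] [TopologicalSpace Z]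
    [TopologicalSpace W] (g : C(Z, W)) (f : C(Y, Z)) :
    singHMap k (g.comp f) = singHMap k g ∘ₗ singHMap k f := by
  unfold singHMap
  rw [TopCat.ofHom_comp, Functor.map_comp]
  rfl

/-- Reduced singular homology: the kernel of `H_k(Y; ℤ) → H_k(point; ℤ)`. -/
def redH (k : ℕ) (Y : Type) [TopologicalSpace Y] : Submodule ℤ (singH k Y) :=
  LinearMap.ker (singHMap k (ContinuousMap.const Y PUnit.unit))

theorem singHMap_mem_redH (k : ℕ) {Y : Type} [TopologicalSpace Y] (f : C(Y, Y)) :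
    ∀ x ∈ redH k Y, singHMap k f x ∈ redH k Y := by
  intro x hx
  have h : singHMap k (ContinuousMap.const Y PUnit.unit) ∘ₗ singHMap k f
      = singHMap k (ContinuousMap.const Y PUnit.unit) := by
    rw [← singHMap_comp]; rfl
  have h2 := LinearMap.congr_fun h x
  simp only [redH, LinearMap.mem_ker, LinearMap.comp_apply] at hx h2 ⊢
  rw [h2, hx]

/-- The unit sphere `S^k` in `ℝ^(k+1)`. -/
abbrev Sph (k : ℕ) : Type := sphere (0 : EuclideanSpace ℝ (Fin (k + 1))) 1

/-- The trace of a linear endomorphism on an invariant submodule. -/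
def traceOn {R M : Type*} [CommRing R] [AddCommGroup M] [Module R M] (N : Submodule R M)
    (f : M →ₗ[R] M) (hf : ∀ x ∈ N, f x ∈ N) : R :=
  LinearMap.trace R N (f.restrict hf)

theorem traceOn_eq_zero {R M : Type*} [CommRing R] [AddCommGroup M] [Module R M]
    (N : Submodule R M) (f : M →ₗ[R] M) (hf : ∀ x ∈ N, f x ∈ N) (h : ∀ x ∈ N, f x = 0) :
    traceOn N f hf = 0 := by
  have : f.restrict hf = 0 := by
    ext x
    simpa using h x x.2
  rw [traceOn, this, map_zero]

/-- The degree of a continuous map `f : S^k → S^k`. The reduced homology group of `S^k` in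
dimension `k` is infinite cyclic, and `f_*` is multiplication by the degree on it; the integer is
read off as the trace of this endomorphism. -/
def degree (k : ℕ) (f : C(Sph k, Sph k)) : ℤ :=
  traceOn (redH k (Sph k)) (singHMap k f) (singHMap_mem_redH k f)

theorem degree_const (k : ℕ) (y : Sph k) : degree k (ContinuousMap.const _ y) = 0 := by
  refine traceOn_eq_zero _ _ _ fun x hx => ?_
  have h1 : (ContinuousMap.const (Sph k) y : C(Sph k, Sph k)) =
      (ContinuousMap.const PUnit.{1} y).comp (ContinuousMap.const (Sph k) PUnit.unit) := rfl
  have h2 : singHMap k (ContinuousMap.const (Sph k) PUnit.unit) x = 0 := hx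
  rw [h1, singHMap_comp, LinearMap.comp_apply, h2, map_zero]

/-- A fixed homeomorphism from the one-point compactification of `ℝ^k` onto `S^k`. -/
def onePointHomeo (k : ℕ) : OnePoint (Fin k → ℝ) ≃ₜ Sph k :=
  onePointEquivSphereOfFinrankEq (by simp)

/-- The radial homeomorphism from `S^k` onto the boundary of the unit ball of the maximum norm on
`ℝ^(k+1)`, the domain of the attaching maps. -/
def radial (k : ℕ) (x : Sph k) : Fin (k + 1) → ℝ :=
  ‖WithLp.ofLp (x : EuclideanSpace ℝ (Fin (k + 1)))‖⁻¹ •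
    WithLp.ofLp (x : EuclideanSpace ℝ (Fin (k + 1)))

theorem ofLp_ne_zero (k : ℕ) (x : Sph k) :
    WithLp.ofLp (x : EuclideanSpace ℝ (Fin (k + 1))) ≠ 0 := by
  intro h
  have hx : ‖(x : EuclideanSpace ℝ (Fin (k + 1)))‖ = 1 := by simp
  have : (x : EuclideanSpace ℝ (Fin (k + 1))) = 0 := by
    ext i; simpa using congrFun h i
  rw [this, norm_zero] at hx
  exact zero_ne_one hx

theorem continuous_radial (k : ℕ) : Continuous (radial k) := by
  have h : Continuous fun x : Sph k => WithLp.ofLp (x : EuclideanSpace ℝ (Fin (k + 1))) :=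
    (PiLp.continuous_ofLp 2 _).comp continuous_subtype_val
  exact (h.norm.inv₀ fun x => norm_ne_zero_iff.2 (ofLp_ne_zero k x)).smul h

theorem radial_mem (k : ℕ) (x : Sph k) : radial k x ∈ sphere (0 : Fin (k + 1) → ℝ) 1 := by
  rw [mem_sphere_zero_iff_norm, radial, norm_smul, norm_inv, norm_norm,
    inv_mul_cancel₀ (norm_ne_zero_iff.2 (ofLp_ne_zero k x))]

variable {X : Type*} [TopologicalSpace X] {E : Set X} [CWComplex E]

/-- The set of `k`-cells. -/
abbrev Cell (E : Set X) [CWComplex E] (k : ℕ) : Type _ := cell E k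

open scoped Classical in
/-- The map collapsing the complement of the open `k`-cell `β` to the point `∞`, with the open cell
(an open ball, via the characteristic map) identified with `ℝ^k`. -/
def collapse {k : ℕ} (β : cell E k) (x : X) : OnePoint (Fin k → ℝ) :=
  if x ∈ openCell k β then
    ((OpenPartialHomeomorph.univUnitBall.symm ((map k β).symm x) : Fin k → ℝ) : OnePoint _)
  else OnePoint.infty

theorem symm_mem_ball {k : ℕ} (β : cell E k) {x : X} (hx : x ∈ openCell k β) :
    (map k β).symm x ∈ ball (0 : Fin k → ℝ) 1 ∧ map k β ((map k β).symm x) = x := by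
  obtain ⟨y, hy, rfl⟩ := hx
  rw [← source_eq (C := E) k β] at hy
  refine ⟨?_, (map k β).right_inv ((map k β).map_source hy)⟩
  rw [(map k β).left_inv hy, ← source_eq (C := E) k β]
  exact hy

theorem openCell_eq_target {k : ℕ} (β : cell E k) : openCell k β = (map k β).target := by
  rw [← (map k β).image_source_eq_target, source_eq]; rfl

theorem isClosed_skeleton_diff [T2Space X] {k : ℕ} (β : cell E k) :
    IsClosed ((skeletonLT E ((k : ℕ∞) + 1) : Set X) \ openCell k β) := by
  refine CWComplex.isClosed_of_disjoint_openCell_or_isClosed_inter_closedCell (C := E) ?_ ?_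
  · exact Set.sdiff_subset.trans (RelCWComplex.Subcomplex.subset_complex _)
  intro n _ j
  by_cases hnk : n ≤ k
  · by_cases hj : (⟨n, j⟩ : Σ n, cell E n) = ⟨k, β⟩
    · left
      cases hj
      exact Set.disjoint_sdiff_left
    · right
      have h : (((skeletonLT E ((k : ℕ∞) + 1) : Set X) \ openCell k β) ∩ closedCell n j)
          = closedCell n j := by
        refine Set.inter_eq_right.2 fun x hx => ⟨?_, fun hxβ => ?_⟩
        · refine RelCWComplex.skeletonLT_mono (C := E) (m := (n : ℕ∞) + 1) ?_
            (RelCWComplex.closedCell_subset_skeletonLT n j hx)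
          gcongr
        · rw [← RelCWComplex.cellFrontier_union_openCell_eq_closedCell] at hx
          rcases hx with hx | hx
          · exact Set.disjoint_left.1 (RelCWComplex.disjoint_skeletonLT_openCell (C := E)
              (n := (n : ℕ∞)) (j := β) (by exact_mod_cast hnk))
              (RelCWComplex.cellFrontier_subset_skeletonLT n j hx) hxβ
          · exact Set.disjoint_left.1 (RelCWComplex.disjoint_openCell_of_ne hj) hx hxβ
      rw [h]
      exact RelCWComplex.isClosed_closedCell
  · left
    refine Set.disjoint_of_subset_left Set.sdiff_subset
      (RelCWComplex.disjoint_skeletonLT_openCell ?_)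
    exact_mod_cast Nat.lt_of_not_le hnk

theorem continuousOn_collapse [T2Space X] {k : ℕ} (β : cell E k) :
    ContinuousOn (collapse β) (skeletonLT E ((k : ℕ∞) + 1) : Set X) := by
  intro x hx
  by_cases hxβ : x ∈ openCell k β
  · have h1 : ContinuousWithinAt (fun y : X =>
        ((OpenPartialHomeomorph.univUnitBall.symm ((map k β).symm y) : Fin k → ℝ) :
          OnePoint (Fin k → ℝ))) (openCell k β) x := by
      have hs : ContinuousWithinAt (map k β).symm (openCell k β) x := by
        rw [openCell_eq_target]
        exact continuousOn_symm (C := E) k β x (openCell_eq_target β ▸ hxβ)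
      have hb := (symm_mem_ball β hxβ).1
      have hu : ContinuousAt (OpenPartialHomeomorph.univUnitBall (E := Fin k → ℝ)).symm
          ((map k β).symm x) :=
        OpenPartialHomeomorph.univUnitBall.continuousAt_symm hb
      exact (OnePoint.continuous_coe.continuousAt.comp hu).comp_continuousWithinAt hs
    have h2 : ContinuousWithinAt (collapse β) (openCell k β) x :=
      h1.congr (fun y hy => if_pos hy) (if_pos hxβ)
    refine h2.mono_of_mem_nhdsWithin ?_
    have h3 := (isClosed_skeleton_diff β).isOpen_compl.mem_nhds
      (show x ∈ ((skeletonLT E ((k : ℕ∞) + 1) : Set X) \ openCell k β)ᶜ from fun h => h.2 hxβ)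
    filter_upwards [mem_nhdsWithin_of_mem_nhds h3, self_mem_nhdsWithin] with y hy hy'
    by_contra h
    exact hy ⟨hy', h⟩
  · have hv : collapse β x = OnePoint.infty := if_neg hxβ
    refine ContinuousAt.continuousWithinAt ?_
    rw [ContinuousAt, hv, OnePoint.hasBasis_nhds_infty.tendsto_right_iff]
    rintro K ⟨_, hK⟩
    have hKc : IsCompact (map k β '' (OpenPartialHomeomorph.univUnitBall '' K)) := by
      have : IsCompact (OpenPartialHomeomorph.univUnitBall '' K : Set (Fin k → ℝ)) :=
        hK.image_of_continuousOn
          (OpenPartialHomeomorph.univUnitBall.continuousOn_toFun.mono (Set.subset_univ _))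
      refine this.image_of_continuousOn ((continuousOn (C := E) k β).mono ?_)
      rintro _ ⟨z, _, rfl⟩
      exact ball_subset_closedBall (OpenPartialHomeomorph.univUnitBall.map_source (Set.mem_univ z))
    have hsub : map k β '' (OpenPartialHomeomorph.univUnitBall '' K) ⊆ openCell k β := by
      refine Set.image_mono ?_
      rintro _ ⟨z, _, rfl⟩
      exact OpenPartialHomeomorph.univUnitBall.map_source (Set.mem_univ z)
    filter_upwards [hKc.isClosed.isOpen_compl.mem_nhds fun h => hxβ (hsub h)] with y hy
    by_cases hyβ : y ∈ openCell k β
    · left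
      refine ⟨_, fun hyK => hy ?_, (if_pos hyβ : collapse β y = _).symm⟩
      obtain ⟨hb, hm⟩ := symm_mem_ball β hyβ
      refine ⟨_, ⟨_, hyK, rfl⟩, ?_⟩
      rw [OpenPartialHomeomorph.univUnitBall.right_inv hb, hm]
    · right
      exact if_neg hyβ

/-- The composite `S^k → E^k → S^k` of the attaching map of the `(k+1)`-cell `α` with the map
collapsing the complement of the `k`-cell `β` to a point. -/
def attachCollapse [T2Space X] {k : ℕ} (α : cell E (k + 1)) (β : cell E k) : C(Sph k, Sph k) where
  toFun x := onePointHomeo k (collapse β (map (k + 1) α (radial k x)))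
  continuous_toFun := by
    refine (onePointHomeo k).continuous.comp ?_
    have h1 : Continuous fun x : Sph k => map (k + 1) α (radial k x) :=
      ((continuousOn (C := E) (k + 1) α).mono sphere_subset_closedBall).comp_continuous
        (continuous_radial k) (radial_mem k)
    refine (continuousOn_collapse β).comp_continuous h1 fun x => ?_
    have := RelCWComplex.cellFrontier_subset_skeletonLT (k + 1) α
      (Set.mem_image_of_mem _ (radial_mem k x))
    exact_mod_cast this

/-- A choice of orientations of all cells, given as signs relative to the orientations determined by
the characteristic maps. -/
abbrev Orientation (E : Set X) [CWComplex E] : Type _ := ∀ k, cell E k → ℤˣ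

/-- The incidence number `d_{αβ}` of a `(k+1)`-cell `α` and a `k`-cell `β`: the degree of the
composite of the attaching map of `α` and the map collapsing the complement of `β`. -/
def incidenceNumber [T2Space X] (o : Orientation E) {k : ℕ} (α : cell E (k + 1)) (β : cell E k) :
    ℤ :=
  o (k + 1) α * o k β * degree k (attachCollapse α β)

/-- Each cell has a non-zero incidence number with finitely many cells of the next dimension. -/
def LocallyFinite [T2Space X] (E : Set X) [CWComplex E] (o : Orientation E) : Prop :=
  ∀ (k : ℕ) (β : cell E k), {α : cell E (k + 1) | incidenceNumber o α β ≠ 0}.Finite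

/-- The attaching map of a cell meets finitely many cells, hence has finitely many non-zero
incidence numbers. -/
theorem finite_incidenceNumber_ne_zero [T2Space X] (o : Orientation E) {k : ℕ}
    (α : cell E (k + 1)) : {β : cell E k | incidenceNumber o α β ≠ 0}.Finite := by
  obtain ⟨I, hI⟩ := CWComplex.cellFrontier_subset_finite_openCell (C := E) (k + 1) α
  refine (I k).finite_toSet.subset fun β hβ => ?_
  by_contra hβI
  refine hβ ?_
  have hconst : attachCollapse α β =
      ContinuousMap.const _ (onePointHomeo k OnePoint.infty) := by
    ext1 x
    have hx := hI (Set.mem_image_of_mem _ (radial_mem k x))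
    simp only [Set.mem_iUnion] at hx
    obtain ⟨m, _, j, hj, hx⟩ := hx
    have : map (k + 1) α (radial k x) ∉ openCell k β := by
      refine fun h => Set.disjoint_left.1 (RelCWComplex.disjoint_openCell_of_ne ?_) hx h
      rintro h'
      cases h'
      exact hβI hj
    change onePointHomeo k (collapse β _) = _
    rw [collapse, if_neg this]
    rfl
  rw [incidenceNumber, hconst, degree_const, mul_zero]

end CellularDegrees

end CellKitaev

namespace CellKitaev

noncomputable section Chains

/-- Finite chains on `J` with coefficients in `A`. -/
abbrev FinChain (J A : Type*) [AddCommGroup A] : Type _ := J →₀ A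

/-- An integral matrix with finitely many non-zero entries in each row and each column. -/
structure Incidence (J I : Type*) where
  /-- the matrix entries -/
  coeff : J → I → ℤ
  finite_lower : ∀ j, {i | coeff j i ≠ 0}.Finite
  finite_upper : ∀ i, {j | coeff j i ≠ 0}.Finite

namespace Incidence

variable {J I A : Type*} [AddCommGroup A]

/-- The transposed matrix. -/
def transpose (D : Incidence J I) : Incidence I J where
  coeff i j := D.coeff j i
  finite_lower := D.finite_upper
  finite_upper := D.finite_lower

/-- The boundary `(∂c)_i = ∑_j d_{ji} c_j` of a locally finite chain. -/
def boundary (D : Incidence J I) : (J → A) →+ (I → A) where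
  toFun c i := ∑ j ∈ (D.finite_upper i).toFinset, D.coeff j i • c j
  map_zero' := by
    funext i
    simp
  map_add' c c' := by
    funext i
    simp [Finset.sum_add_distrib]

theorem finite_support_boundary (D : Incidence J I) (c : FinChain J A) :
    (Function.support (D.boundary c)).Finite := by
  refine (c.support.finite_toSet.biUnion fun j _ => D.finite_lower j).subset fun i hi => ?_
  obtain ⟨j, _, hj⟩ := Finset.exists_ne_zero_of_sum_ne_zero (Function.mem_support.1 hi)
  refine Set.mem_biUnion (x := j) ?_ ?_
  · refine Finset.mem_coe.2 (Finsupp.mem_support_iff.2 fun h => hj ?_)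
    rw [h, smul_zero]
  · intro h
    exact hj (by rw [h, zero_smul])

/-- The restriction of the boundary map to finite chains. -/
def boundaryFin (D : Incidence J I) : FinChain J A →+ FinChain I A where
  toFun c := Finsupp.ofSupportFinite (D.boundary c) (D.finite_support_boundary c)
  map_zero' := by
    ext i
    simp [Finsupp.ofSupportFinite]
  map_add' c c' := by
    ext i
    change D.boundary (⇑(c + c')) i = D.boundary c i + D.boundary c' i
    rw [Finsupp.coe_add, map_add, Pi.add_apply]

/-- The locally finite chain `γ` has finite boundary. -/
def FiniteBoundary (D : Incidence J I) (γ : J → A) : Prop :=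
  (Function.support (D.boundary γ)).Finite

/-- The differential `∂(a, c) = (-∂a, a + ∂c)` of the mapping cone of the inclusion of the finite
chains into the locally finite chains; `D` and `D'` are the matrices of two consecutive
boundary maps. -/
def coneBoundary {L : Type*} (D : Incidence J I) (D' : Incidence I L) :
    FinChain I A × (J → A) →+ FinChain L A × (I → A) where
  toFun x := (-D'.boundaryFin x.1, x.1 + D.boundary x.2)
  map_zero' := by simp
  map_add' x y := by
    ext i
    · simp [add_comm]
    · simp [add_add_add_comm]

/-- The element `(-∂γ, γ)` of the mapping cone, for a locally finite chain `γ` with finite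
boundary. -/
def cycleAtInfinity {L : Type*} (D' : Incidence I L) (γ : I → A)
    (hγ : D'.FiniteBoundary γ) : FinChain L A × (I → A) :=
  (-Finsupp.ofSupportFinite (D'.boundary γ) hγ, γ)

/-- `(-∂γ, γ)` and `(-∂γ', γ')` differ in a boundary of the mapping cone, i.e. represent the same
class at infinity. -/
def SameClassAtInfinity {L : Type*} (D : Incidence J I) (D' : Incidence I L) (γ γ' : I → A)
    (hγ : D'.FiniteBoundary γ)
    (hγ' : D'.FiniteBoundary γ') : Prop :=
  ∃ x, coneBoundary D D' x = D'.cycleAtInfinity γ hγ - D'.cycleAtInfinity γ' hγ'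

end Incidence

end Chains

end CellKitaev

namespace CellKitaev

noncomputable section QuasiLocal

open scoped Classical ENNReal

set_option linter.unusedSectionVars false

/-- The operator on `ℓ²(C)` sending `ψ` to the function equal to `ψ (f s)` at the points `s`
satisfying `p` and to `0` elsewhere, where `f` is injective on these points. -/
def pullOp {C : Type*} (p : C → Prop) (f : C → C) (hf : Set.InjOn f {s | p s}) :
    lp (fun _ : C => ℂ) 2 →L[ℂ] lp (fun _ : C => ℂ) 2 :=
  have key : ∀ (ψ : lp (fun _ : C => ℂ) 2) (F : Finset C),
      ∑ s ∈ F, ‖(if p s then ψ (f s) else 0 : ℂ)‖ ^ (2 : ℝ≥0∞).toReal ≤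
        ‖ψ‖ ^ (2 : ℝ≥0∞).toReal := by
    intro ψ F
    have h2 : (0 : ℝ) < (2 : ℝ≥0∞).toReal := by norm_num
    calc ∑ s ∈ F, ‖(if p s then ψ (f s) else 0 : ℂ)‖ ^ (2 : ℝ≥0∞).toReal
        = ∑ s ∈ F with p s, ‖ψ (f s)‖ ^ (2 : ℝ≥0∞).toReal := by
          rw [Finset.sum_filter]
          refine Finset.sum_congr rfl fun s _ => ?_
          split_ifs
          · rfl
          · simp
      _ = ∑ s ∈ (F.filter p).image f, ‖ψ s‖ ^ (2 : ℝ≥0∞).toReal := by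
          rw [Finset.sum_image]
          intro x hx y hy hxy
          exact hf (Finset.mem_filter.1 hx).2 (Finset.mem_filter.1 hy).2 hxy
      _ ≤ _ := lp.sum_rpow_le_norm_rpow h2 ψ _
  LinearMap.mkContinuous
    { toFun := fun ψ => ⟨fun s => if p s then ψ (f s) else 0, memℓp_gen' (key ψ)⟩
      map_add' := fun φ ψ => lp.ext <| funext fun s => by
        change (if p s then φ (f s) + ψ (f s) else 0) =
          (if p s then φ (f s) else 0) + (if p s then ψ (f s) else 0)
        by_cases h : p s <;> simp [h]
      map_smul' := fun c ψ => lp.ext <| funext fun s => by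
        change (if p s then c * ψ (f s) else 0) = c * (if p s then ψ (f s) else 0)
        by_cases h : p s <;> simp [h] }
    1 fun ψ => by
      rw [one_mul]
      exact lp.norm_le_of_forall_sum_le (by norm_num) (norm_nonneg _) (key ψ)

theorem pullOp_apply {C : Type*} (p : C → Prop) (f : C → C) (hf : Set.InjOn f {s | p s})
    (ψ : lp (fun _ : C => ℂ) 2) (s : C) : pullOp p f hf ψ s = if p s then ψ (f s) else 0 := rfl

variable {I G : Type*}

variable (I G) in
/-- The Hilbert space `ℓ²(G^I)` with orthonormal basis the configurations `I → G`. -/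
abbrev ConfSpace : Type _ := lp (fun _ : I → G => ℂ) 2

/-- Replace the values of the configuration `s` on `Λ` by those of `t`. -/
def glue (Λ : Finset I) (s : I → G) (t : Λ → G) : I → G :=
  fun i => if h : i ∈ Λ then t ⟨i, h⟩ else s i

theorem glue_mem (Λ : Finset I) (s : I → G) (t : Λ → G) (i : Λ) : glue Λ s t i = t i := by
  simp [glue]

theorem glue_not_mem (Λ : Finset I) (s : I → G) (t : Λ → G) {i : I} (h : i ∉ Λ) :
    glue Λ s t i = s i := by
  simp [glue, h]

theorem restrict_glue (Λ : Finset I) (s : I → G) (t : Λ → G) :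
    Λ.restrict (glue Λ s t) = t := funext fun i => glue_mem Λ s t i

theorem glue_glue (Λ : Finset I) (s : I → G) (t t' : Λ → G) :
    glue Λ (glue Λ s t) t' = glue Λ s t' := by
  funext i
  by_cases h : i ∈ Λ <;> simp [glue, h]

theorem glue_restrict (Λ : Finset I) (s : I → G) : glue Λ s (Λ.restrict s) = s := by
  funext i
  by_cases h : i ∈ Λ <;> simp [glue, h]

theorem glue_of_restrict {Λ : Finset I} {s : I → G} {t : Λ → G} (h : Λ.restrict s = t) :
    glue Λ s t = s := by
  rw [← h, glue_restrict]

/-- The matrix unit `|u⟩⟨t|` of the sites in `Λ`, acting on `ℓ²(G^I)`. -/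
def matUnit (Λ : Finset I) (u t : Λ → G) : ConfSpace I G →L[ℂ] ConfSpace I G :=
  pullOp (fun s => Λ.restrict s = u) (fun s => glue Λ s t) <| by
    intro s hs s' hs' h
    have h1 := congrArg (fun x => glue Λ x u) h
    simp only [glue_glue] at h1
    have hs : Λ.restrict s = u := hs
    have hs' : Λ.restrict s' = u := hs'
    rw [← hs, glue_restrict, hs, ← hs', glue_restrict] at h1
    exact h1

theorem matUnit_apply (Λ : Finset I) (u t : Λ → G) (ψ : ConfSpace I G) (s : I → G) :
    matUnit Λ u t ψ s = if Λ.restrict s = u then ψ (glue Λ s t) else 0 := by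
  refine (pullOp_apply _ _ _ ψ s).trans ?_
  congr

theorem op_ext {S T : ConfSpace I G →L[ℂ] ConfSpace I G} (h : ∀ ψ s, S ψ s = T ψ s) : S = T :=
  ContinuousLinearMap.ext fun ψ => lp.ext (funext fun s => h ψ s)

theorem op_one_apply (ψ : ConfSpace I G) (s : I → G) :
    (1 : ConfSpace I G →L[ℂ] ConfSpace I G) ψ s = ψ s := rfl

theorem op_mul_apply (S T : ConfSpace I G →L[ℂ] ConfSpace I G) (ψ : ConfSpace I G) (s : I → G) :
    (S * T) ψ s = S (T ψ) s := rfl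

theorem op_smul_apply (c : ℂ) (T : ConfSpace I G →L[ℂ] ConfSpace I G) (ψ : ConfSpace I G)
    (s : I → G) : (c • T) ψ s = c * T ψ s := rfl

theorem op_sum_apply {ι : Type*} (F : Finset ι) (T : ι → ConfSpace I G →L[ℂ] ConfSpace I G)
    (ψ : ConfSpace I G) (s : I → G) : (∑ i ∈ F, T i) ψ s = ∑ i ∈ F, T i ψ s := by
  have h : (∑ i ∈ F, T i) ψ = ∑ i ∈ F, T i ψ := sum_apply _ _ _
  rw [h, lp.coeFn_sum, Finset.sum_apply]

theorem star_matUnit (Λ : Finset I) (u t : Λ → G) : star (matUnit Λ u t) = matUnit Λ t u := by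
  rw [ContinuousLinearMap.star_eq_adjoint, eq_comm, ContinuousLinearMap.eq_adjoint_iff]
  intro φ ψ
  rw [lp.inner_eq_tsum, lp.inner_eq_tsum]
  simp only [matUnit_apply]
  have h1 : Function.support (fun s : I → G =>
      inner ℂ (if Λ.restrict s = t then φ (glue Λ s u) else 0) (ψ s)) ⊆
      {s | Λ.restrict s = t} := by
    intro s hs
    by_contra h
    exact hs (by simp [show ¬ Λ.restrict s = t from h])
  have h2 : Function.support (fun s : I → G =>
      inner ℂ (φ s) (if Λ.restrict s = u then ψ (glue Λ s t) else 0)) ⊆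
      {s | Λ.restrict s = u} := by
    intro s hs
    by_contra h
    exact hs (by simp [show ¬ Λ.restrict s = u from h])
  rw [← tsum_subtype_eq_of_support_subset h1, ← tsum_subtype_eq_of_support_subset h2]
  let e : {s : I → G | Λ.restrict s = t} ≃ {s : I → G | Λ.restrict s = u} :=
    { toFun := fun s => ⟨glue Λ s u, restrict_glue Λ _ u⟩
      invFun := fun s => ⟨glue Λ s t, restrict_glue Λ _ t⟩
      left_inv := fun s => Subtype.ext ((glue_glue Λ s u t).trans
        (glue_of_restrict (show Λ.restrict (s : I → G) = t from s.2)))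
      right_inv := fun s => Subtype.ext ((glue_glue Λ s t u).trans
        (glue_of_restrict (show Λ.restrict (s : I → G) = u from s.2))) }
  rw [← e.tsum_eq]
  refine tsum_congr fun s => ?_
  have hs : Λ.restrict (s : I → G) = t := s.2
  have he : ((e s : {s : I → G | Λ.restrict s = u}) : I → G) = glue Λ (s : I → G) u := rfl
  rw [he, restrict_glue, if_pos rfl, if_pos hs, glue_glue, glue_of_restrict hs]

variable [Fintype G]

/-- The operator `A ⊗ 1` on `ℓ²(G^I)` for an operator `A` on the sites in the finite set `Λ`, given
by its matrix with respect to the basis `|t⟩`, `t : Λ → G`, of `ℓ²(G)^{⊗ Λ}`. -/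
def localOp (Λ : Finset I) (A : Matrix (Λ → G) (Λ → G) ℂ) : ConfSpace I G →L[ℂ] ConfSpace I G :=
  ∑ u : Λ → G, ∑ t : Λ → G, A u t • matUnit Λ u t

theorem localOp_apply (Λ : Finset I) (A : Matrix (Λ → G) (Λ → G) ℂ) (ψ : ConfSpace I G)
    (s : I → G) :
    localOp Λ A ψ s = ∑ t : Λ → G, A (Λ.restrict s) t * ψ (glue Λ s t) := by
  simp only [localOp, op_sum_apply, op_smul_apply, matUnit_apply, mul_ite, mul_zero]
  rw [Finset.sum_comm]
  refine Finset.sum_congr rfl fun t _ => ?_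
  simp

variable (G) in
/-- The faithful representation of `B(ℓ²(G)^{⊗ Λ})` on `ℓ²(G^I)` by `A ↦ A ⊗ 1`. -/
def localRep (Λ : Finset I) :
    Matrix (Λ → G) (Λ → G) ℂ →⋆ₐ[ℂ] (ConfSpace I G →L[ℂ] ConfSpace I G) where
  toFun := localOp Λ
  map_one' := by
    refine op_ext fun ψ s => ?_
    rw [localOp_apply, op_one_apply]
    simp [Matrix.one_apply, glue_restrict]
  map_mul' A B := by
    refine op_ext fun ψ s => ?_
    rw [op_mul_apply, localOp_apply, localOp_apply]
    simp only [localOp_apply, restrict_glue, glue_glue, Matrix.mul_apply, Finset.sum_mul,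
      Finset.mul_sum]
    rw [Finset.sum_comm]
    simp only [mul_assoc]
  map_zero' := by simp [localOp]
  map_add' A B := by simp [localOp, add_smul, Finset.sum_add_distrib]
  commutes' c := by
    refine op_ext fun ψ s => ?_
    rw [localOp_apply, Algebra.algebraMap_eq_smul_one (A := ConfSpace I G →L[ℂ] ConfSpace I G),
      op_smul_apply, op_one_apply]
    simp [Matrix.algebraMap_matrix_apply, glue_restrict]
  map_star' A := by
    simp only [localOp, star_sum, star_smul, star_matUnit]
    rw [Finset.sum_comm]
    rfl

theorem localRep_injective [Nonempty G] (Λ : Finset I) : Function.Injective (localRep (I := I) G Λ) := by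
  rw [injective_iff_map_eq_zero]
  intro A hA
  ext u t
  let s : I → G := fun _ => Classical.arbitrary G
  have h : localOp Λ A (lp.single 2 (glue Λ s t) 1) (glue Λ s u) = 0 := by
    have hA : localOp Λ A = 0 := hA
    rw [hA]
    rfl
  rw [localOp_apply, restrict_glue, Finset.sum_eq_single t] at h
  · rw [glue_glue, lp.single_apply_self, mul_one] at h
    exact h
  · intro t' _ ht'
    rw [glue_glue, lp.single_apply_ne, mul_zero]
    intro h'
    have := congrArg Λ.restrict h'
    rw [restrict_glue, restrict_glue] at this
    exact ht' this
  · simp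

variable (I G) in
/-- The C*-subalgebra of `B(ℓ²(G^I))` generated by the operators `A ⊗ 1` with `A` an operator on
finitely many sites. -/
def quasiLocalSubalgebra : StarSubalgebra ℂ (ConfSpace I G →L[ℂ] ConfSpace I G) :=
  (StarAlgebra.adjoin ℂ (⋃ Λ : Finset I, Set.range (localRep G Λ))).topologicalClosure

variable (I G) in
/-- The quasi-local algebra with Hilbert space `ℓ²(G)` at each site of `I`: the completion of the
union of the algebras `B(ℓ²(G)^{⊗ Λ})`, `Λ ⊆ I` finite, under `A ↦ A ⊗ 1`. -/
def QuasiLocalAlgebra : Type _ := quasiLocalSubalgebra I G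

instance : IsClosed (quasiLocalSubalgebra I G : Set (ConfSpace I G →L[ℂ] ConfSpace I G)) :=
  StarSubalgebra.isClosed_topologicalClosure _

instance : CStarAlgebra (QuasiLocalAlgebra I G) :=
  inferInstanceAs (CStarAlgebra (quasiLocalSubalgebra I G))

instance : PartialOrder (QuasiLocalAlgebra I G) := CStarAlgebra.spectralOrder _

instance : StarOrderedRing (QuasiLocalAlgebra I G) := CStarAlgebra.spectralOrderedRing _

variable (I G) in
/-- The inclusion of the quasi-local algebra into `B(ℓ²(G^I))`. -/
def toOp : QuasiLocalAlgebra I G →⋆ₐ[ℂ] (ConfSpace I G →L[ℂ] ConfSpace I G) :=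
  (quasiLocalSubalgebra I G).subtype

theorem toOp_injective : Function.Injective (toOp I G) := Subtype.val_injective

theorem isometry_toOp : Isometry (toOp I G) := fun _ _ => rfl

theorem localRep_mem (Λ : Finset I) (A : Matrix (Λ → G) (Λ → G) ℂ) :
    localRep G Λ A ∈ quasiLocalSubalgebra I G :=
  StarSubalgebra.le_topologicalClosure _
    (StarAlgebra.subset_adjoin ℂ _ (Set.mem_iUnion.2 ⟨Λ, A, rfl⟩))

/-- The embedding of the local algebra `B(ℓ²(G)^{⊗ Λ})` into the quasi-local algebra. -/
def localObs (Λ : Finset I) : Matrix (Λ → G) (Λ → G) ℂ →⋆ₐ[ℂ] QuasiLocalAlgebra I G :=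
  (localRep G Λ).codRestrict (quasiLocalSubalgebra I G) (localRep_mem Λ)

theorem toOp_localObs (Λ : Finset I) (A : Matrix (Λ → G) (Λ → G) ℂ) :
    toOp I G (localObs Λ A) = localOp Λ A := rfl

/-- The tensor product over the sites in `Λ` of the operators `A i`. -/
def siteProduct (Λ : Finset I) (A : I → Matrix G G ℂ) : Matrix (Λ → G) (Λ → G) ℂ :=
  Matrix.of fun s t => ∏ i : Λ, A i (s i) (t i)

theorem siteProduct_star (Λ : Finset I) (A : I → Matrix G G ℂ) :
    star (siteProduct Λ A) = siteProduct Λ fun i => star (A i) := by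
  ext s t
  simp [siteProduct, Matrix.star_apply, star_prod]

variable [AddCommGroup G]

/-- The operator `X^g : |h⟩ ↦ |g + h⟩` on `ℓ²(G)`. -/
def pauliX (g : G) : Matrix G G ℂ := Matrix.of fun h h' => if h = g + h' then 1 else 0

/-- The operator `Z^χ : |h⟩ ↦ χ(h) |h⟩` on `ℓ²(G)`. -/
def pauliZ (χ : AddChar G ℂ) : Matrix G G ℂ := Matrix.diagonal fun h => χ h

/-- The operator `X^a`, the product over the sites `i` of the operators `X^{a_i}` at `i`. -/
def opX (a : FinChain I G) : QuasiLocalAlgebra I G :=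
  localObs a.support (siteProduct a.support fun i => pauliX (a i))

/-- The operator `Z^b`, the product over the sites `i` of the operators `Z^{b_i}` at `i`. -/
def opZ (b : FinChain I (AddChar G ℂ)) : QuasiLocalAlgebra I G :=
  localObs b.support (siteProduct b.support fun i => pauliZ (b i))

theorem star_pauliX (g : G) : star (pauliX g) = pauliX (-g) := by
  ext h h'
  have : (h' = g + h) ↔ (h = -g + h') := by
    constructor <;> rintro rfl <;> abel
  simp [pauliX, Matrix.star_apply, this, apply_ite]

theorem star_pauliZ (χ : AddChar G ℂ) : star (pauliZ χ) = pauliZ (-χ) := by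
  rw [pauliZ, Matrix.star_eq_conjTranspose, Matrix.diagonal_conjTranspose, pauliZ]
  congr 1
  funext h
  simp [AddChar.neg_apply, AddChar.map_neg_eq_conj]

theorem siteProduct_pauliX_apply (Λ : Finset I) (a : FinChain I G) (ha : a.support ⊆ Λ)
    (ψ : ConfSpace I G) (s : I → G) :
    localOp Λ (siteProduct Λ fun i => pauliX (a i)) ψ s = ψ (s - a) := by
  rw [localOp_apply, Finset.sum_eq_single (fun i : Λ => s i - a i)]
  · have h1 : siteProduct Λ (fun i => pauliX (a i)) (Λ.restrict s) (fun i : Λ => s i - a i) = 1 := by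
      simp [siteProduct, pauliX]
    have h2 : glue Λ s (fun i : Λ => s i - a i) = s - a := by
      funext i
      by_cases h : i ∈ Λ
      · exact glue_mem Λ s _ ⟨i, h⟩
      · have : a i = 0 := Finsupp.notMem_support_iff.1 fun h' => h (ha h')
        rw [glue_not_mem Λ s _ h, Pi.sub_apply, this, sub_zero]
    rw [h1, h2, one_mul]
  · intro t _ ht
    obtain ⟨i, hi⟩ := Function.ne_iff.1 ht
    have : siteProduct Λ (fun i => pauliX (a i)) (Λ.restrict s) t = 0 := by
      rw [siteProduct, Matrix.of_apply]
      refine Finset.prod_eq_zero (Finset.mem_univ i) ?_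
      rw [pauliX, Matrix.of_apply, if_neg]
      intro h
      have h : s i = a i + t i := h
      exact hi (by rw [h]; abel)
    rw [this, zero_mul]
  · simp

theorem siteProduct_pauliZ_apply (Λ : Finset I) (b : FinChain I (AddChar G ℂ)) (hb : b.support ⊆ Λ)
    (ψ : ConfSpace I G) (s : I → G) :
    localOp Λ (siteProduct Λ fun i => pauliZ (b i)) ψ s = (b.prod fun i χ => χ (s i)) * ψ s := by
  rw [localOp_apply, Finset.sum_eq_single (Λ.restrict s), glue_restrict]
  · congr 1
    rw [Finsupp.prod_of_support_subset b hb _ (by simp), ← Finset.prod_coe_sort]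
    simp [siteProduct, pauliZ]
  · intro t _ ht
    obtain ⟨i, hi⟩ := Function.ne_iff.1 ht
    have : siteProduct Λ (fun i => pauliZ (b i)) (Λ.restrict s) t = 0 := by
      rw [siteProduct, Matrix.of_apply]
      refine Finset.prod_eq_zero (Finset.mem_univ i) ?_
      rw [pauliZ, Matrix.diagonal_apply_ne _ (Ne.symm hi)]
    rw [this, zero_mul]
  · simp

theorem opX_apply (a : FinChain I G) (ψ : ConfSpace I G) (s : I → G) :
    toOp I G (opX a) ψ s = ψ (s - a) :=
  siteProduct_pauliX_apply _ _ subset_rfl _ _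

theorem opZ_apply (b : FinChain I (AddChar G ℂ)) (ψ : ConfSpace I G) (s : I → G) :
    toOp I G (opZ b) ψ s = (b.prod fun i χ => χ (s i)) * ψ s :=
  siteProduct_pauliZ_apply _ _ subset_rfl _ _

theorem qla_ext {A B : QuasiLocalAlgebra I G} (h : ∀ ψ s, toOp I G A ψ s = toOp I G B ψ s) :
    A = B :=
  toOp_injective (op_ext h)

theorem opX_add (a a' : FinChain I G) : opX (a + a') = opX a * opX a' := by
  refine qla_ext fun ψ s => ?_
  rw [map_mul, op_mul_apply, opX_apply, opX_apply, opX_apply, Finsupp.coe_add, sub_sub]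

theorem opZ_add (b b' : FinChain I (AddChar G ℂ)) : opZ (b + b') = opZ b * opZ b' := by
  refine qla_ext fun ψ s => ?_
  rw [map_mul, op_mul_apply, opZ_apply, opZ_apply, opZ_apply, ← mul_assoc,
    Finsupp.prod_add_index' (by simp) (by simp)]

theorem opX_zero : opX (0 : FinChain I G) = 1 := by
  refine qla_ext fun ψ s => ?_
  rw [map_one, op_one_apply, opX_apply, Finsupp.coe_zero, sub_zero]

theorem opZ_zero : opZ (0 : FinChain I (AddChar G ℂ)) = 1 := by
  refine qla_ext fun ψ s => ?_
  rw [map_one, op_one_apply, opZ_apply, Finsupp.prod_zero_index, one_mul]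

theorem star_opX (a : FinChain I G) : star (opX a) = opX (-a) := by
  refine qla_ext fun ψ s => ?_
  rw [opX_apply, opX, ← map_star, siteProduct_star, toOp_localObs]
  simp only [star_pauliX]
  exact siteProduct_pauliX_apply _ (-a) (by simp) ψ s

theorem star_opZ (b : FinChain I (AddChar G ℂ)) : star (opZ b) = opZ (-b) := by
  refine qla_ext fun ψ s => ?_
  rw [opZ_apply, opZ, ← map_star, siteProduct_star, toOp_localObs]
  simp only [star_pauliZ]
  exact siteProduct_pauliZ_apply _ (-b) (by simp) ψ s

theorem opX_mem_unitary (a : FinChain I G) : opX a ∈ unitary (QuasiLocalAlgebra I G) := by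
  rw [Unitary.mem_iff, star_opX, ← opX_add, ← opX_add, neg_add_cancel, add_neg_cancel, opX_zero]
  exact ⟨rfl, rfl⟩

theorem opZ_mem_unitary (b : FinChain I (AddChar G ℂ)) : opZ b ∈ unitary (QuasiLocalAlgebra I G) := by
  rw [Unitary.mem_iff, star_opZ, ← opZ_add, ← opZ_add]
  have h1 : -b + b = 0 := neg_add_cancel b
  have h2 : b + -b = 0 := add_neg_cancel b
  rw [h1, h2, opZ_zero]
  exact ⟨rfl, rfl⟩

theorem commute_opX (a : FinChain I G) (Λ : Finset I) (ha : ∀ i ∈ Λ, a i = 0)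
    (A : Matrix (Λ → G) (Λ → G) ℂ) : Commute (opX a) (localObs Λ A) := by
  refine qla_ext fun ψ s => ?_
  rw [map_mul, map_mul, op_mul_apply, op_mul_apply, opX_apply, toOp_localObs, localOp_apply,
    localOp_apply]
  refine Finset.sum_congr rfl fun t _ => ?_
  have h1 : Λ.restrict (s - (a : I → G)) = Λ.restrict s := by
    funext i
    simp [ha i i.2]
  have h2 : glue Λ (s - (a : I → G)) t = glue Λ s t - (a : I → G) := by
    funext i
    by_cases h : i ∈ Λ <;> simp [glue, h, ha]
  rw [h1, h2, opX_apply]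

theorem commute_opZ (b : FinChain I (AddChar G ℂ)) (Λ : Finset I) (hb : ∀ i ∈ Λ, b i = 0)
    (A : Matrix (Λ → G) (Λ → G) ℂ) : Commute (opZ b) (localObs Λ A) := by
  refine qla_ext fun ψ s => ?_
  rw [map_mul, map_mul, op_mul_apply, op_mul_apply, opZ_apply, toOp_localObs, localOp_apply,
    localOp_apply, Finset.mul_sum]
  refine Finset.sum_congr rfl fun t _ => ?_
  have h2 : (b.prod fun i χ => χ (glue Λ s t i)) = b.prod fun i χ => χ (s i) := by
    refine Finsupp.prod_congr fun i hi => ?_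
    have : i ∉ Λ := fun h => Finsupp.mem_support_iff.1 hi (hb i h)
    rw [glue_not_mem Λ s t this]
  rw [opZ_apply, h2]
  ring

/-- The restriction of the family `c` to the finite set `K`. -/
def truncate {A : Type*} [AddCommGroup A] (c : I → A) (K : Finset I) : FinChain I A :=
  Finsupp.indicator K fun i _ => c i

theorem truncate_apply {A : Type*} [AddCommGroup A] (c : I → A) {K : Finset I} {i : I}
    (h : i ∈ K) : truncate c K i = c i := by
  simp [truncate, h]

/-- Conjugation `A ↦ U A U*` by a unitary. -/
def conj (U : QuasiLocalAlgebra I G) (hU : U ∈ unitary (QuasiLocalAlgebra I G)) :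
    QuasiLocalAlgebra I G →⋆ₐ[ℂ] QuasiLocalAlgebra I G :=
  (Unitary.conjStarAlgAut ℂ (QuasiLocalAlgebra I G) ⟨U, hU⟩ : _ →⋆ₐ[ℂ] _)

theorem conj_apply (U : QuasiLocalAlgebra I G) (hU : U ∈ unitary (QuasiLocalAlgebra I G))
    (A : QuasiLocalAlgebra I G) : conj U hU A = U * A * star U := rfl

theorem conj_eq_of_commute (U V : QuasiLocalAlgebra I G)
    (hU : U ∈ unitary (QuasiLocalAlgebra I G)) (hV : V ∈ unitary (QuasiLocalAlgebra I G))
    (A : QuasiLocalAlgebra I G) (h : Commute (star V * U) A) : conj U hU A = conj V hV A := by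
  have h1 : V * star V = 1 := hV.2
  have h2 : U * star U = 1 := hU.2
  calc U * A * star U = V * (star V * U * A) * star U := by
        simp only [← mul_assoc, h1, one_mul]
    _ = V * (A * (star V * U)) * star U := by rw [h.eq]
    _ = V * A * star V * (U * star U) := by simp only [mul_assoc]
    _ = V * A * star V := by rw [h2, mul_one]

open Filter in
/-- A net of *-endomorphisms that is eventually constant on each local observable converges
pointwise in norm. -/
theorem exists_tendsto_of_local
    (φ : Finset I → QuasiLocalAlgebra I G →⋆ₐ[ℂ] QuasiLocalAlgebra I G)
    (h : ∀ (Λ : Finset I) (A : Matrix (Λ → G) (Λ → G) ℂ) (K : Finset I), Λ ⊆ K →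
      φ K (localObs Λ A) = φ Λ (localObs Λ A)) (A : QuasiLocalAlgebra I G) :
    ∃ L, Tendsto (fun K => φ K A) atTop (nhds L) := by
  let S : StarSubalgebra ℂ (QuasiLocalAlgebra I G) :=
    { carrier := {A | ∃ L, Tendsto (fun K => φ K A) atTop (nhds L)}
      mul_mem' := by
        rintro A B ⟨L, hL⟩ ⟨M, hM⟩
        exact ⟨L * M, by simpa only [map_mul] using hL.mul hM⟩
      add_mem' := by
        rintro A B ⟨L, hL⟩ ⟨M, hM⟩
        exact ⟨L + M, by simpa only [map_add] using hL.add hM⟩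
      algebraMap_mem' := fun r => ⟨algebraMap ℂ _ r, by
        simpa only [AlgHomClass.commutes] using tendsto_const_nhds⟩
      star_mem' := by
        rintro A ⟨L, hL⟩
        exact ⟨star L, by simpa only [map_star] using hL.star⟩ }
  have hclosed : IsClosed (S : Set (QuasiLocalAlgebra I G)) := by
    refine isClosed_of_closure_subset fun A hA => ?_
    change ∃ L, Tendsto (fun K => φ K A) atTop (nhds L)
    refine cauchy_map_iff_exists_tendsto.1 ?_
    rw [Metric.cauchy_iff]
    refine ⟨inferInstance, fun ε hε => ?_⟩
    obtain ⟨B, ⟨L, hL⟩, hAB⟩ := Metric.mem_closure_iff.1 hA (ε / 4) (by linarith)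
    refine ⟨Metric.ball L (ε / 2), ?_, ?_⟩
    · have := hL.eventually (Metric.ball_mem_nhds L (show 0 < ε / 4 by linarith))
      rw [mem_map]
      filter_upwards [this] with K hK
      have h1 : dist (φ K A) (φ K B) ≤ dist A B := by
        rw [dist_eq_norm, dist_eq_norm, ← map_sub]
        exact NonUnitalStarAlgHom.norm_apply_le (φ K) _
      have h2 : dist (φ K B) L < ε / 4 := hK
      have h3 := dist_triangle (φ K A) (φ K B) L
      show dist (φ K A) L < ε / 2
      linarith
    · intro x hx y hy
      have h1 : dist x L < ε / 2 := hx
      have h2 : dist y L < ε / 2 := hy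
      have h3 := dist_triangle_right x y L
      linarith
  have hmap : quasiLocalSubalgebra I G ≤ S.map (quasiLocalSubalgebra I G).subtype := by
    refine StarSubalgebra.topologicalClosure_minimal ?_ ?_
    · refine StarAlgebra.adjoin_le ?_
      intro T hT
      obtain ⟨Λ, B, rfl⟩ := Set.mem_iUnion.1 hT
      refine ⟨localObs Λ B, ⟨φ Λ (localObs Λ B), ?_⟩, rfl⟩
      refine tendsto_const_nhds.congr' ?_
      filter_upwards [eventually_ge_atTop Λ] with K hK
      exact (h Λ B K hK).symm
    · exact (isometry_toOp (I := I) (G := G)).isClosedEmbedding.isClosedMap _ hclosed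
  obtain ⟨B, hB, hBA⟩ := hmap A.2
  have : B = A := Subtype.ext hBA
  exact this ▸ hB

open Filter in
/-- The pointwise norm limit of a net of *-endomorphisms. -/
def limHom (φ : Finset I → QuasiLocalAlgebra I G →⋆ₐ[ℂ] QuasiLocalAlgebra I G)
    (h : ∀ A, ∃ L, Tendsto (fun K => φ K A) atTop (nhds L)) :
    QuasiLocalAlgebra I G →⋆ₐ[ℂ] QuasiLocalAlgebra I G :=
  have key : ∀ A, Tendsto (fun K => φ K A) atTop (nhds (limUnder atTop fun K => φ K A)) :=
    fun A => tendsto_nhds_limUnder (h A)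
  { toFun := fun A => limUnder atTop fun K => φ K A
    map_one' := tendsto_nhds_unique (key 1) (by simpa only [map_one] using tendsto_const_nhds)
    map_mul' := fun A B => tendsto_nhds_unique (key (A * B))
      (by simpa only [map_mul] using (key A).mul (key B))
    map_zero' := tendsto_nhds_unique (key 0) (by simpa only [map_zero] using tendsto_const_nhds)
    map_add' := fun A B => tendsto_nhds_unique (key (A + B))
      (by simpa only [map_add] using (key A).add (key B))
    commutes' := fun r => tendsto_nhds_unique (key _)
      (by simpa only [AlgHomClass.commutes] using tendsto_const_nhds)
    map_star' := fun A => tendsto_nhds_unique (key (star A))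
      (by simpa only [map_star] using (key A).star) }

/-- The endomorphism `ρ_γ(A) = lim_K Z^{γ_K} A (Z^{γ_K})*`, the limit being over the finite sets `K`
of sites. -/
def rhoZ (γ : I → AddChar G ℂ) : QuasiLocalAlgebra I G →⋆ₐ[ℂ] QuasiLocalAlgebra I G :=
  limHom (fun K => conj (opZ (truncate γ K)) (opZ_mem_unitary _)) <|
    exists_tendsto_of_local _ fun Λ A K hK => by
      refine conj_eq_of_commute _ _ _ _ _ ?_
      rw [star_opZ, ← opZ_add]
      refine commute_opZ _ _ (fun i hi => ?_) _
      rw [Finsupp.add_apply, Finsupp.neg_apply, truncate_apply γ hi, truncate_apply γ (hK hi),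
        neg_add_cancel]

/-- The endomorphism `ρ_δ(A) = lim_K X^{δ_K} A (X^{δ_K})*`, the limit being over the finite sets `K`
of sites. -/
def rhoX (δ : I → G) : QuasiLocalAlgebra I G →⋆ₐ[ℂ] QuasiLocalAlgebra I G :=
  limHom (fun K => conj (opX (truncate δ K)) (opX_mem_unitary _)) <|
    exists_tendsto_of_local _ fun Λ A K hK => by
      refine conj_eq_of_commute _ _ _ _ _ ?_
      rw [star_opX, ← opX_add]
      refine commute_opX _ _ (fun i hi => ?_) _
      rw [Finsupp.add_apply, Finsupp.neg_apply, truncate_apply δ hi, truncate_apply δ (hK hi),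
        neg_add_cancel]

/-- The endomorphism `ρ_{(γ,δ)} = ρ_γ ∘ ρ_δ`. -/
def rho (γ : I → AddChar G ℂ) (δ : I → G) : QuasiLocalAlgebra I G →⋆ₐ[ℂ] QuasiLocalAlgebra I G :=
  (rhoZ γ).comp (rhoX δ)

open scoped ComplexOrder in
variable (I G) in
/-- Positive linear functionals on the quasi-local algebra. -/
abbrev PositiveFunctional : Type _ := QuasiLocalAlgebra I G →ₚ[ℂ] ℂ

open scoped ComplexOrder in
/-- The functional `ω ∘ φ` for a *-endomorphism `φ`. -/
def pullback (ω : PositiveFunctional I G)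
    (φ : QuasiLocalAlgebra I G →⋆ₐ[ℂ] QuasiLocalAlgebra I G) : PositiveFunctional I G :=
  ω.comp (PositiveLinearMap.ofClass φ)

/-- Unitary equivalence of representations of a C*-algebra on Hilbert spaces. -/
def UnitarilyEquivalent {A H₁ H₂ : Type*} [CStarAlgebra A]
    [NormedAddCommGroup H₁] [InnerProductSpace ℂ H₁] [CompleteSpace H₁]
    [NormedAddCommGroup H₂] [InnerProductSpace ℂ H₂] [CompleteSpace H₂]
    (π₁ : A →⋆ₐ[ℂ] (H₁ →L[ℂ] H₁)) (π₂ : A →⋆ₐ[ℂ] (H₂ →L[ℂ] H₂)) : Prop :=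
  ∃ U : H₁ ≃ₗᵢ[ℂ] H₂, ∀ a x, U (π₁ a x) = π₂ a (U x)

open scoped ComplexOrder in
/-- The GNS representations of two positive functionals are unitarily equivalent. -/
def GNSEquivalent (ω ω' : PositiveFunctional I G) : Prop :=
  UnitarilyEquivalent (H₁ := ω.GNS) (H₂ := ω'.GNS) ω.gnsStarAlgHom ω'.gnsStarAlgHom

end QuasiLocal

end CellKitaev

namespace CellKitaev

noncomputable section Model

open Topology

universe u

variable {X : Type u} [TopologicalSpace X]

/-- The set of `(n-1)`-cells, which is empty for `n = 0`. -/
def lowerCell (E : Set X) [CWComplex E] : ℕ → Type u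
  | 0 => PEmpty
  | n + 1 => Cell E n

variable [T2Space X] {E : Set X} [CWComplex E]

/-- The incidence numbers of the `(n+1)`-cells and the `n`-cells. -/
def upper (o : Orientation E) (hE : LocallyFinite E o) (n : ℕ) :
    Incidence (Cell E (n + 1)) (Cell E n) where
  coeff α β := incidenceNumber o α β
  finite_lower := finite_incidenceNumber_ne_zero o
  finite_upper := hE n

/-- The incidence numbers of the `n`-cells and the `(n-1)`-cells. -/
def lower (o : Orientation E) (hE : LocallyFinite E o) :
    ∀ n, Incidence (Cell E n) (lowerCell E n)
  | 0 =>
    { coeff := fun _ i => i.elim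
      finite_lower := fun _ => Set.toFinite (α := PEmpty) _
      finite_upper := fun i => i.elim }
  | n + 1 => upper o hE n

variable {G : Type*} [AddCommGroup G] [Fintype G]

/-- The star operator `A_α = |G|⁻¹ ∑_g X^{∂ᵀ(g e_α)}` of an `(n-1)`-cell `α`. -/
def starOp (o : Orientation E) (hE : LocallyFinite E o) (G : Type*) [AddCommGroup G] [Fintype G]
    (n : ℕ) (α : lowerCell E n) : QuasiLocalAlgebra (Cell E n) G :=
  (Fintype.card G : ℂ)⁻¹ •
    ∑ g : G, opX ((lower o hE n).transpose.boundaryFin (Finsupp.single α g))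

/-- The plaquette operator `B_β = |G|⁻¹ ∑_χ Z^{∂(χ e_β)}` of an `(n+1)`-cell `β`. -/
def plaquetteOp (o : Orientation E) (hE : LocallyFinite E o) (G : Type*) [AddCommGroup G]
    [Fintype G] (n : ℕ) (β : Cell E (n + 1)) :
    QuasiLocalAlgebra (Cell E n) G :=
  (Fintype.card G : ℂ)⁻¹ •
    ∑ χ : AddChar G ℂ, opZ ((upper o hE n).boundaryFin (Finsupp.single β χ))

/-- A state that minimises each of the interaction terms `-A_α` and `-B_β` (these are negatives of
projections, so the minimal value is `-1`). -/
structure IsFrustrationFreeGroundState (o : Orientation E) (hE : LocallyFinite E o) (n : ℕ)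
    (ω : PositiveFunctional (Cell E n) G) : Prop where
  map_one : ω 1 = 1
  map_starOp : ∀ α, ω (starOp o hE G n α) = 1
  map_plaquetteOp : ∀ β, ω (plaquetteOp o hE G n β) = 1

end Model

end CellKitaev

/-! Equality of the classes at infinity says that `γ = ∂c + a + γ'` and `δ = ∂ᵀe + d + δ'` with `a`,
`d` finitely supported. The endomorphisms turn sums into compositions (`rhoZ_add`, `rhoX_add`), and
`ρ_γ` commutes with `ρ_δ` because `Z` and `X` operators commute up to a phase, which drops out of
conjugations (`rhoZ_comp_rhoX`). The three summands can therefore be treated separately.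

The finite summands act by inner automorphisms: together they give conjugation by the unitary `W =
Z^a X^d`.

The boundary summands are invisible to `ω₀` (`state_apply_boundary_eq`). On an observable localized
in a finite set, `ρ_{∂c}` is conjugation by `Z^{∂b}` for a finite chain `b` that agrees with `c`
near this set. A state with value 1 on an average of unitaries has value 1 on each of them, and by
Cauchy–Schwarz it absorbs such unitaries on either side. So `ω₀` has value 1 on all `Z^{∂b}` and is
unchanged by conjugation with them; density and continuity extend this to the whole algebra. The
same argument applies to `X^{∂ᵀb}`.

Hence `ω₀ ∘ ρ_{(γ,δ)} = ω₀ ∘ ρ_{(γ',δ')} ∘ Ad W`, and precomposing a positive functional with an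
inner automorphism does not change its GNS representation up to unitary equivalence
(`unitarilyEquivalent_gns_of_conj`). -/

/-! ### GNS representations and inner automorphisms. -/

open scoped ComplexOrder in
/-- The unitary right multiplication by `W*` intertwines the GNS representations of `f ∘ Ad W`
and `f`. -/
theorem CellKitaev.unitarilyEquivalent_gns_of_conj {A : Type*} [CStarAlgebra A] [PartialOrder A]
    [StarOrderedRing A] (f f' : A →ₚ[ℂ] ℂ) (W : A) (hW : W ∈ unitary A)
    (h : ∀ a, f' a = f (W * a * star W)) :
    CellKitaev.UnitarilyEquivalent (H₁ := f'.GNS) (H₂ := f.GNS)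
      f'.gnsStarAlgHom f.gnsStarAlgHom := by
  have hW1 : star W * W = 1 := hW.1
  have hW2 : W * star W = 1 := hW.2
  let e : f'.PreGNS ≃ₗ[ℂ] f.PreGNS :=
    { toFun := fun x => f.toPreGNS (f'.ofPreGNS x * star W)
      invFun := fun y => f'.toPreGNS (f.ofPreGNS y * W)
      map_add' := fun x y => by simp [add_mul]
      map_smul' := fun c x => by simp
      left_inv := fun x => by simp [mul_assoc, hW1]
      right_inv := fun x => by simp [mul_assoc, hW2] }
  -- The squared norm of `x W*` under `f` is `f (W x* x W*)`, which is `f' (x* x)`.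
  have he : ∀ x, ‖e x‖ = ‖x‖ := by
    intro x
    change ‖f.toPreGNS (f'.ofPreGNS x * star W)‖ = ‖x‖
    rw [PositiveLinearMap.preGNS_norm_def, PositiveLinearMap.preGNS_norm_def, h]
    simp [mul_assoc]
  let T : f'.PreGNS ≃ₗᵢ[ℂ] f.PreGNS := ⟨e, he⟩
  let L : f'.PreGNS →L[ℂ] f.PreGNS := T.toContinuousLinearEquiv
  let M : f.PreGNS →L[ℂ] f'.PreGNS := T.symm.toContinuousLinearEquiv
  -- Extending the inverse to the completions as well makes the extension bijective; the two
  -- identities hold on the dense image and pass to the limit.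
  let V : f'.GNS ≃ₗ[ℂ] f.GNS := LinearEquiv.ofLinearMap L.completion.toLinearMap
    M.completion.toLinearMap
    (by
      ext x
      induction x using UniformSpace.Completion.induction_on with
      | hp => exact isClosed_eq (L.completion.continuous.comp M.completion.continuous) continuous_id
      | ih x => simp [L, M])
    (by
      ext x
      induction x using UniformSpace.Completion.induction_on with
      | hp => exact isClosed_eq (M.completion.continuous.comp L.completion.continuous) continuous_id
      | ih x => simp [L, M])
  refine ⟨⟨V, fun x => ?_⟩, fun a x => ?_⟩
  · change ‖L.completion x‖ = ‖x‖
    induction x using UniformSpace.Completion.induction_on with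
    | hp => exact isClosed_eq L.completion.continuous.norm continuous_norm
    | ih x => simp [L]
  · change L.completion (f'.gnsStarAlgHom a x) = f.gnsStarAlgHom a (L.completion x)
    induction x using UniformSpace.Completion.induction_on with
    | hp => apply isClosed_eq <;> fun_prop
    | ih x =>
      have h1 : f'.gnsStarAlgHom a (x : f'.GNS) = (f'.leftMulMapPreGNS a x : f'.PreGNS) :=
        f'.gnsNonUnitalStarAlgHom_apply_coe
      have h2 : f.gnsStarAlgHom a (L x : f.PreGNS) = (f.leftMulMapPreGNS a (L x) : f.PreGNS) :=
        f.gnsNonUnitalStarAlgHom_apply_coe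
      rw [h1, ContinuousLinearMap.completion_apply_coe, ContinuousLinearMap.completion_apply_coe,
        h2]
      -- Left multiplication by `a` commutes with right multiplication by `W*`.
      exact congrArg _ (congrArg f.toPreGNS (mul_assoc a (f'.ofPreGNS x) (star W)))

/-! ### States and unitaries of expectation one. -/

namespace PositiveLinearMap

open scoped ComplexOrder

variable {A : Type*} [CStarAlgebra A] [PartialOrder A] [StarOrderedRing A] (f : A →ₚ[ℂ] ℂ)

/-- Cauchy–Schwarz for the GNS vectors of `1` and `u`, both of norm one. -/
theorem norm_apply_unitary_le_one (hf : f 1 = 1) {u : A} (hu : u ∈ unitary A) : ‖f u‖ ≤ 1 := by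
  have hu1 : star u * u = 1 := hu.1
  have h := norm_inner_le_norm (𝕜 := ℂ) (f.toPreGNS 1) (f.toPreGNS u)
  rw [preGNS_inner_def, preGNS_norm_def, preGNS_norm_def] at h
  simpa [hu1, hf] using h

/-- The vector of `u - 1` has squared GNS norm `2 - f u - f u* = 0`, and `f (a * (u - 1))` is its
inner product with the vector of `a*`. -/
theorem apply_mul_unitary_of_apply_eq_one (hf : f 1 = 1) {u : A} (hu : u ∈ unitary A)
    (h : f u = 1) (a : A) : f (a * u) = f a := by
  have hu1 : star u * u = 1 := hu.1
  have hs : f (star u) = 1 := by rw [map_star, h, star_one]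
  have h0 : ‖f.toPreGNS (u - 1)‖ = 0 := by
    rw [preGNS_norm_def]
    simp [sub_mul, mul_sub, hu1, hf, h, hs]
  have h1 := norm_inner_le_norm (𝕜 := ℂ) (f.toPreGNS (star a)) (f.toPreGNS (u - 1))
  rw [h0, mul_zero, preGNS_inner_def] at h1
  have h2 : f (a * (u - 1)) = 0 := by simpa using h1
  rw [mul_sub, mul_one, map_sub] at h2
  exact sub_eq_zero.1 h2

theorem apply_unitary_mul_of_apply_eq_one (hf : f 1 = 1) {u : A} (hu : u ∈ unitary A)
    (h : f u = 1) (a : A) : f (u * a) = f a := by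
  have h1 := f.apply_mul_unitary_of_apply_eq_one hf (Unitary.star_mem hu)
    (by rw [map_star, h, star_one]) (star a)
  rw [← star_mul, map_star, map_star] at h1
  exact star_injective h1

theorem apply_conj_unitary_of_apply_eq_one (hf : f 1 = 1) {u : A} (hu : u ∈ unitary A)
    (h : f u = 1) (a : A) : f (u * a * star u) = f a := by
  rw [f.apply_mul_unitary_of_apply_eq_one hf (Unitary.star_mem hu)
    (by rw [map_star, h, star_one]), f.apply_unitary_mul_of_apply_eq_one hf hu h]

/-- If a state takes the value `1` on an average of unitaries, then it does so on each of them. -/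
theorem apply_eq_one_of_apply_average_eq_one (hf : f 1 = 1) {ι : Type*} [Fintype ι] (u : ι → A)
    (hu : ∀ i, u i ∈ unitary A) (h : f ((Fintype.card ι : ℂ)⁻¹ • ∑ i, u i) = 1) (i : ι) :
    f (u i) = 1 := by
  have : Nonempty ι := ⟨i⟩
  have hcard : (Fintype.card ι : ℂ) ≠ 0 := Nat.cast_ne_zero.2 Fintype.card_ne_zero
  have hle : ∀ j, ‖f (u j)‖ ≤ 1 := fun j => f.norm_apply_unitary_le_one hf (hu j)
  have hre : ∀ j, (f (u j)).re ≤ 1 := fun j => (Complex.re_le_norm _).trans (hle j)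
  rw [map_smul, map_sum, smul_eq_mul, inv_mul_eq_one₀ hcard] at h
  -- The summands are nonnegative, so each of them vanishes.
  have hsum : ∑ j, (1 - (f (u j)).re) = 0 := by
    rw [Finset.sum_sub_distrib, ← Complex.re_sum, ← h]
    simp
  have hi : (f (u i)).re = 1 := by
    have := (Finset.sum_eq_zero_iff_of_nonneg fun j _ => sub_nonneg.2 (hre j)).1 hsum i
      (Finset.mem_univ i)
    linarith
  -- With real part 1 and modulus at most 1, no imaginary part is left.
  have hn : (f (u i)).re * (f (u i)).re + (f (u i)).im * (f (u i)).im ≤ 1 := by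
    rw [← Complex.normSq_apply, Complex.normSq_eq_norm_sq]
    exact pow_le_one₀ (norm_nonneg _) (hle i)
  refine Complex.ext hi ?_
  rw [hi] at hn
  exact mul_self_eq_zero.1 (le_antisymm (by linarith) (mul_self_nonneg _))

end PositiveLinearMap

namespace CellKitaev

open Filter

set_option linter.unusedSectionVars false

/-! ### Finite approximation of boundaries and the relation at infinity. -/

namespace Incidence

variable {J I A : Type*} [AddCommGroup A]

/-- Local finiteness enters here: only finitely many entries of `c` contribute to `∂c` on the finite
set `Λ`, so `c` may be cut off to them. -/
theorem exists_boundaryFin_eq_on (D : Incidence J I) (c : J → A) (Λ : Finset I) :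
    ∃ b : FinChain J A, ∀ i ∈ Λ, D.boundaryFin b i = D.boundary c i := by
  classical
  refine ⟨truncate c (Λ.biUnion fun i => (D.finite_upper i).toFinset), fun i hi => ?_⟩
  change D.boundary _ i = _
  refine Finset.sum_congr rfl fun j hj => ?_
  rw [truncate_apply c (Finset.mem_biUnion.2 ⟨i, hi, hj⟩)]

/-- This is the second component of the mapping cone equation. The boundary is written first so that
its endomorphism is the outermost one, next to the state. -/
theorem SameClassAtInfinity.exists_eq_add {L : Type*} {D : Incidence J I} {D' : Incidence I L}
    {γ γ' : I → A} {hγ : D'.FiniteBoundary γ} {hγ' : D'.FiniteBoundary γ'}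
    (h : SameClassAtInfinity D D' γ γ' hγ hγ') :
    ∃ (a : FinChain I A) (c : J → A), γ = D.boundary c + (a + γ') := by
  obtain ⟨⟨a, c⟩, hx⟩ := h
  have h2 : (a : I → A) + D.boundary c = γ - γ' := congrArg Prod.snd hx
  refine ⟨a, c, ?_⟩
  rw [← add_assoc, add_comm (D.boundary c), h2, sub_add_cancel]

end Incidence

/-! ### Limits of conjugations by local unitaries, for `X` and `Z` at once. -/

variable {I G : Type*} [Fintype G] [AddCommGroup G]

/-- Seen in `B(ℓ²(G^I))`, the closure of `S` is a closed star subalgebra, as the inclusion is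
isometric. It contains the generators of the quasi-local algebra, hence everything. -/
theorem dense_of_localObs_mem (S : StarSubalgebra ℂ (QuasiLocalAlgebra I G))
    (h : ∀ (Λ : Finset I) (A : Matrix (Λ → G) (Λ → G) ℂ), localObs Λ A ∈ S) :
    Dense (S : Set (QuasiLocalAlgebra I G)) := by
  have hmap : quasiLocalSubalgebra I G ≤
      S.topologicalClosure.map (quasiLocalSubalgebra I G).subtype := by
    refine StarSubalgebra.topologicalClosure_minimal ?_ ?_
    · refine StarAlgebra.adjoin_le ?_
      intro T hT
      obtain ⟨Λ, B, rfl⟩ := Set.mem_iUnion.1 hT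
      exact ⟨localObs Λ B, S.le_topologicalClosure (h Λ B), rfl⟩
    · exact (isometry_toOp (I := I) (G := G)).isClosedEmbedding.isClosedMap _
        S.isClosed_topologicalClosure
  intro A
  obtain ⟨B, hB, hBA⟩ := hmap A.2
  have : B = A := Subtype.ext hBA
  exact this ▸ hB

theorem starAlgHom_ext_localObs {φ ψ : QuasiLocalAlgebra I G →⋆ₐ[ℂ] QuasiLocalAlgebra I G}
    (h : ∀ (Λ : Finset I) (A : Matrix (Λ → G) (Λ → G) ℂ),
      φ (localObs Λ A) = ψ (localObs Λ A)) : φ = ψ := by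
  have hd := dense_of_localObs_mem (StarAlgHom.equalizer φ ψ) h
  exact DFunLike.coe_injective
    (Continuous.ext_on hd (map_continuous φ) (map_continuous ψ) fun A hA => hA)

/-- A representation by unitaries of the finite families with values in `B` such that the family
`b` acts on the sites in its support. -/
structure IsLocalUnitaryRep {B : Type*} [AddCommGroup B]
    (op : FinChain I B → QuasiLocalAlgebra I G) : Prop where
  zero : op 0 = 1
  add : ∀ b b', op (b + b') = op b * op b'
  star_op : ∀ b, star (op b) = op (-b)
  commute : ∀ (b : FinChain I B) (Λ : Finset I), (∀ i ∈ Λ, b i = 0) →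
    ∀ A : Matrix (Λ → G) (Λ → G) ℂ, Commute (op b) (localObs Λ A)

theorem isLocalUnitaryRep_opX : IsLocalUnitaryRep (opX (I := I) (G := G)) :=
  ⟨opX_zero, opX_add, star_opX, commute_opX⟩

theorem isLocalUnitaryRep_opZ : IsLocalUnitaryRep (opZ (I := I) (G := G)) :=
  ⟨opZ_zero, opZ_add, star_opZ, commute_opZ⟩

variable {B : Type*} [AddCommGroup B]

/-- The endomorphism `ρ` is the limit over finite sets `K` of the conjugations by `op (γ_K)`. -/
def IsLimitConj (op : FinChain I B → QuasiLocalAlgebra I G) (γ : I → B)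
    (ρ : QuasiLocalAlgebra I G →⋆ₐ[ℂ] QuasiLocalAlgebra I G) : Prop :=
  ∀ A, Tendsto (fun K => op (truncate γ K) * A * star (op (truncate γ K))) atTop (nhds (ρ A))

theorem isLimitConj_limHom {op : FinChain I B → QuasiLocalAlgebra I G} {γ : I → B}
    (hop : ∀ b, op b ∈ unitary (QuasiLocalAlgebra I G))
    (h : ∀ A, ∃ L, Tendsto (fun K => conj (op (truncate γ K)) (hop _) A) atTop (nhds L)) :
    IsLimitConj op γ (limHom (fun K => conj (op (truncate γ K)) (hop _)) h) :=
  fun A => tendsto_nhds_limUnder (h A)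

theorem isLimitConj_rhoZ (γ : I → AddChar G ℂ) : IsLimitConj opZ γ (rhoZ γ) :=
  isLimitConj_limHom opZ_mem_unitary _

theorem isLimitConj_rhoX (δ : I → G) : IsLimitConj opX δ (rhoX δ) :=
  isLimitConj_limHom opX_mem_unitary _

/-- The element `A` commutes with the operators of all families that vanish on `Λ`. -/
def IsLocalizedIn (op : FinChain I B → QuasiLocalAlgebra I G) (Λ : Finset I)
    (A : QuasiLocalAlgebra I G) : Prop :=
  ∀ b : FinChain I B, (∀ i ∈ Λ, b i = 0) → Commute (op b) A

namespace IsLocalUnitaryRep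

variable {op : FinChain I B → QuasiLocalAlgebra I G} (hop : IsLocalUnitaryRep op)
include hop

theorem mem_unitary (b : FinChain I B) : op b ∈ unitary (QuasiLocalAlgebra I G) := by
  rw [Unitary.mem_iff, hop.star_op, ← hop.add, ← hop.add, neg_add_cancel, add_neg_cancel, hop.zero]
  exact ⟨rfl, rfl⟩

theorem commute_op (b b' : FinChain I B) : Commute (op b) (op b') := by
  rw [Commute, SemiconjBy, ← hop.add, ← hop.add, add_comm]

theorem isLocalizedIn_localObs (Λ : Finset I) (A : Matrix (Λ → G) (Λ → G) ℂ) :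
    IsLocalizedIn op Λ (localObs Λ A) := fun b hb => hop.commute b Λ hb A

/-- The two unitaries differ by `op (-b' + b)`, whose family vanishes on `Λ`, so that it commutes
with `A`. -/
theorem conj_eq_conj {Λ : Finset I} {A : QuasiLocalAlgebra I G} (hA : IsLocalizedIn op Λ A)
    {b b' : FinChain I B} (h : ∀ i ∈ Λ, b i = b' i) :
    op b * A * star (op b) = op b' * A * star (op b') := by
  refine conj_eq_of_commute _ _ (hop.mem_unitary b) (hop.mem_unitary b') A ?_
  rw [hop.star_op, ← hop.add]
  refine hA _ fun i hi => ?_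
  rw [Finsupp.add_apply, Finsupp.neg_apply, h i hi, neg_add_cancel]

/-- The net is constant once `K` contains `Λ`. The freedom in choosing `b` off `Λ` is essential: `b`
can be taken to be the boundary of a finite chain. -/
theorem apply_eq_conj {γ : I → B} {ρ : QuasiLocalAlgebra I G →⋆ₐ[ℂ] QuasiLocalAlgebra I G}
    (hρ : IsLimitConj op γ ρ) {Λ : Finset I} {A : QuasiLocalAlgebra I G}
    (hA : IsLocalizedIn op Λ A) {b : FinChain I B} (h : ∀ i ∈ Λ, b i = γ i) :
    ρ A = op b * A * star (op b) := by
  refine tendsto_nhds_unique (hρ A) (tendsto_const_nhds.congr' ?_)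
  filter_upwards [eventually_ge_atTop Λ] with K hK
  refine hop.conj_eq_conj hA fun i hi => ?_
  rw [h i hi, truncate_apply γ (hK hi)]

/-- The operators `op b` commute with each other because `B` is abelian. This permits a second use
of `apply_eq_conj` with the same `Λ`, without exhibiting the conjugate as a local matrix. -/
theorem isLocalizedIn_conj {Λ : Finset I} {A : QuasiLocalAlgebra I G}
    (hA : IsLocalizedIn op Λ A) (b : FinChain I B) :
    IsLocalizedIn op Λ (op b * A * star (op b)) := by
  intro b' hb'
  refine ((hop.commute_op b' b).mul_right (hA b' hb')).mul_right ?_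
  rw [hop.star_op]
  exact hop.commute_op _ _

/-- The elements localized in some finite set of sites. -/
def localizedSubalgebra : StarSubalgebra ℂ (QuasiLocalAlgebra I G) where
  carrier := {A | ∃ Λ, IsLocalizedIn op Λ A}
  mul_mem' := by
    classical
    rintro A A' ⟨Λ, hA⟩ ⟨Λ', hA'⟩
    exact ⟨Λ ∪ Λ', fun b hb => (hA b fun i hi => hb i (Finset.mem_union_left _ hi)).mul_right
      (hA' b fun i hi => hb i (Finset.mem_union_right _ hi))⟩
  add_mem' := by
    classical
    rintro A A' ⟨Λ, hA⟩ ⟨Λ', hA'⟩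
    exact ⟨Λ ∪ Λ', fun b hb => (hA b fun i hi => hb i (Finset.mem_union_left _ hi)).add_right
      (hA' b fun i hi => hb i (Finset.mem_union_right _ hi))⟩
  algebraMap_mem' c := ⟨∅, fun b _ => (Algebra.commutes c (op b)).symm⟩
  star_mem' := by
    rintro A ⟨Λ, hA⟩
    refine ⟨Λ, fun b hb => ?_⟩
    -- Adjoints replace `op (-b)` by `op b`, so the relation is needed for `-b`.
    have h := (hA (-b) fun i hi => by rw [Finsupp.neg_apply, hb i hi, neg_zero]).star_star
    rwa [hop.star_op, neg_neg] at h

/-- On an observable of `Λ` all three maps are conjugations by operators of truncations to `Λ`,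
where additivity of `op` applies. -/
theorem eq_comp_of_isLimitConj {γ γ' : I → B}
    {ρ ρ' σ : QuasiLocalAlgebra I G →⋆ₐ[ℂ] QuasiLocalAlgebra I G} (hρ : IsLimitConj op γ ρ)
    (hρ' : IsLimitConj op γ' ρ') (hσ : IsLimitConj op (γ + γ') σ) : σ = ρ.comp ρ' := by
  refine starAlgHom_ext_localObs fun Λ A => ?_
  have hA := hop.isLocalizedIn_localObs Λ A
  have h1 := hop.apply_eq_conj hρ' hA fun i hi => truncate_apply γ' hi
  have h2 := hop.apply_eq_conj hρ (hop.isLocalizedIn_conj hA (truncate γ' Λ))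
    fun i hi => truncate_apply γ hi
  have h3 := hop.apply_eq_conj hσ hA (b := truncate γ Λ + truncate γ' Λ) fun i hi => by
    rw [Finsupp.add_apply, truncate_apply γ hi, truncate_apply γ' hi, Pi.add_apply]
  rw [StarAlgHom.comp_apply, h1, h2, h3, hop.add, star_mul]
  simp only [mul_assoc]

/-- A finitely supported family can serve as its own approximation on every `Λ`, so the limit is
inner. -/
theorem apply_eq_conj_of_finChain {a : FinChain I B}
    {ρ : QuasiLocalAlgebra I G →⋆ₐ[ℂ] QuasiLocalAlgebra I G} (hρ : IsLimitConj op a ρ)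
    (A : QuasiLocalAlgebra I G) : ρ A = op a * A * star (op a) := by
  have h : ρ = conj (op a) (hop.mem_unitary a) := starAlgHom_ext_localObs fun Λ A =>
    hop.apply_eq_conj hρ (hop.isLocalizedIn_localObs Λ A) fun i _ => rfl
  exact h ▸ rfl

-- On a localized element `ρ` is conjugation by some `op b` of expectation one, which the state
-- absorbs; such elements are dense and both sides are continuous.
open scoped ComplexOrder in
theorem state_apply_eq {γ : I → B} {ρ : QuasiLocalAlgebra I G →⋆ₐ[ℂ] QuasiLocalAlgebra I G}
    (hρ : IsLimitConj op γ ρ) (ω : PositiveFunctional I G) (hω : ω 1 = 1)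
    (h : ∀ Λ : Finset I, ∃ b, ω (op b) = 1 ∧ ∀ i ∈ Λ, b i = γ i) (A : QuasiLocalAlgebra I G) :
    ω (ρ A) = ω A := by
  have hd := dense_of_localObs_mem hop.localizedSubalgebra
    fun Λ A => ⟨Λ, hop.isLocalizedIn_localObs Λ A⟩
  refine congrFun (Continuous.ext_on (f := fun A => ω (ρ A)) hd
    ((map_continuous ω).comp (map_continuous ρ)) (map_continuous ω) ?_) A
  rintro A ⟨Λ, hA⟩
  obtain ⟨b, hb, hbγ⟩ := h Λ
  change ω (ρ A) = ω A
  rw [hop.apply_eq_conj hρ hA hbγ]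
  exact ω.apply_conj_unitary_of_apply_eq_one hω (hop.mem_unitary b) hb A

/-- By absorption, the families on which the state has value one are closed under addition, so the
generators `g e_j` suffice. -/
theorem state_boundaryFin_eq_one {J : Type*} (D : Incidence J I) (ω : PositiveFunctional I G)
    (hω : ω 1 = 1) (h : ∀ j g, ω (op (D.boundaryFin (Finsupp.single j g))) = 1)
    (c : FinChain J B) : ω (op (D.boundaryFin c)) = 1 := by
  induction c using Finsupp.induction_linear with
  | zero => rw [map_zero, hop.zero, hω]
  | add c c' hc hc' =>
    rw [map_add, hop.add, ω.apply_mul_unitary_of_apply_eq_one hω (hop.mem_unitary _) hc', hc]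
  | single j g => exact h j g

theorem state_apply_boundary_eq {J : Type*} (D : Incidence J I) (c : J → B)
    {ρ : QuasiLocalAlgebra I G →⋆ₐ[ℂ] QuasiLocalAlgebra I G}
    (hρ : IsLimitConj op (D.boundary c) ρ) (ω : PositiveFunctional I G) (hω : ω 1 = 1)
    (h : ∀ j g, ω (op (D.boundaryFin (Finsupp.single j g))) = 1) (A : QuasiLocalAlgebra I G) :
    ω (ρ A) = ω A := by
  refine hop.state_apply_eq hρ ω hω (fun Λ => ?_) A
  obtain ⟨b, hb⟩ := D.exists_boundaryFin_eq_on c Λ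
  exact ⟨D.boundaryFin b, hop.state_boundaryFin_eq_one D ω hω h b, hb⟩

end IsLocalUnitaryRep

/-! ### Composition and commutation of the `Z` and `X` endomorphisms. -/

theorem rhoZ_add (γ γ' : I → AddChar G ℂ) : rhoZ (γ + γ') = (rhoZ γ).comp (rhoZ γ') :=
  isLocalUnitaryRep_opZ.eq_comp_of_isLimitConj (isLimitConj_rhoZ _) (isLimitConj_rhoZ _)
    (isLimitConj_rhoZ _)

theorem rhoX_add (δ δ' : I → G) : rhoX (δ + δ') = (rhoX δ).comp (rhoX δ') :=
  isLocalUnitaryRep_opX.eq_comp_of_isLimitConj (isLimitConj_rhoX _) (isLimitConj_rhoX _)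
    (isLimitConj_rhoX _)

/-- Weyl relation: `X^a` shifts the configuration by `a`, and `χ(s) = χ(a) χ(s - a)` at each site.
-/
theorem opZ_mul_opX (b : FinChain I (AddChar G ℂ)) (a : FinChain I G) :
    opZ b * opX a = (b.prod fun i χ => χ (a i)) • (opX a * opZ b) := by
  refine qla_ext fun ψ s => ?_
  rw [map_smul, op_smul_apply, map_mul, map_mul, op_mul_apply, op_mul_apply, opZ_apply, opX_apply,
    opX_apply, opZ_apply, ← mul_assoc, ← Finsupp.prod_mul]
  congr 1
  refine Finsupp.prod_congr fun i _ => ?_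
  rw [← AddChar.map_add_eq_mul, Pi.sub_apply, add_sub_cancel]

/-- The Weyl phase has modulus one and meets its conjugate in a conjugation. -/
theorem conj_opZ_opX_comm (b : FinChain I (AddChar G ℂ)) (a : FinChain I G)
    (A : QuasiLocalAlgebra I G) :
    opZ b * (opX a * A * star (opX a)) * star (opZ b) =
      opX a * (opZ b * A * star (opZ b)) * star (opX a) := by
  have hnorm : ‖b.prod fun i χ => χ (a i)‖ = 1 := by
    rw [Finsupp.prod, norm_prod]
    exact Finset.prod_eq_one fun i _ => AddChar.norm_apply _ _
  generalize hc : (b.prod fun i χ => χ (a i)) = c at hnorm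
  have hcc : star c * c = 1 := by
    rw [Complex.star_def, Complex.conj_mul', hnorm]
    simp
  calc opZ b * (opX a * A * star (opX a)) * star (opZ b)
      = (opZ b * opX a) * A * star (opZ b * opX a) := by
        rw [star_mul]
        simp only [mul_assoc]
    _ = (star c * c) • ((opX a * opZ b) * A * star (opX a * opZ b)) := by
        rw [opZ_mul_opX, hc, star_smul, smul_mul_assoc, smul_mul_smul_comm, mul_comm c]
    _ = _ := by
        rw [hcc, one_smul, star_mul]
        simp only [mul_assoc]

theorem isLocalizedIn_opZ_opX {a : FinChain I G} {Λ : Finset I} (ha : a.support ⊆ Λ) :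
    IsLocalizedIn opZ Λ (opX a) :=
  fun b hb => commute_opZ b _ (fun i hi => hb i (ha hi)) _

theorem isLocalizedIn_opX_opZ {b : FinChain I (AddChar G ℂ)} {Λ : Finset I}
    (hb : b.support ⊆ Λ) : IsLocalizedIn opX Λ (opZ b) :=
  fun a ha => commute_opX a _ (fun i hi => ha i (hb hi)) _

theorem support_truncate_subset {A : Type*} [AddCommGroup A] (c : I → A) (K : Finset I) :
    (truncate c K).support ⊆ K := Finsupp.support_indicator_subset _ _

theorem rhoZ_comp_rhoX (γ : I → AddChar G ℂ) (δ : I → G) :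
    (rhoZ γ).comp (rhoX δ) = (rhoX δ).comp (rhoZ γ) := by
  refine starAlgHom_ext_localObs fun Λ A => ?_
  have hZ := isLocalUnitaryRep_opZ.isLocalizedIn_localObs Λ A
  have hX := isLocalUnitaryRep_opX.isLocalizedIn_localObs Λ A
  have h1 := isLocalUnitaryRep_opX.apply_eq_conj (isLimitConj_rhoX δ) hX
    fun i hi => truncate_apply δ hi
  have h2 := isLocalUnitaryRep_opZ.apply_eq_conj (isLimitConj_rhoZ γ) hZ
    fun i hi => truncate_apply γ hi
  -- The truncated `X` operator is supported in `Λ`, so conjugating by it preserves localization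
  -- with respect to `Z`; `hXZ` is the mirror image.
  have hZX : IsLocalizedIn opZ Λ
      (opX (truncate δ Λ) * localObs Λ A * star (opX (truncate δ Λ))) := by
    intro b hb
    refine ((isLocalizedIn_opZ_opX (support_truncate_subset δ Λ) b hb).mul_right
      (hZ b hb)).mul_right ?_
    rw [star_opX]
    refine isLocalizedIn_opZ_opX ?_ b hb
    rw [Finsupp.support_neg]
    exact support_truncate_subset δ Λ
  have hXZ : IsLocalizedIn opX Λ
      (opZ (truncate γ Λ) * localObs Λ A * star (opZ (truncate γ Λ))) := by
    intro a ha
    refine ((isLocalizedIn_opX_opZ (support_truncate_subset γ Λ) a ha).mul_right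
      (hX a ha)).mul_right ?_
    rw [star_opZ]
    refine isLocalizedIn_opX_opZ ?_ a ha
    rw [Finsupp.support_neg]
    exact support_truncate_subset γ Λ
  rw [StarAlgHom.comp_apply, StarAlgHom.comp_apply, h1, h2,
    isLocalUnitaryRep_opZ.apply_eq_conj (isLimitConj_rhoZ γ) hZX
      fun i hi => truncate_apply γ hi,
    isLocalUnitaryRep_opX.apply_eq_conj (isLimitConj_rhoX δ) hXZ
      fun i hi => truncate_apply δ hi]
  exact conj_opZ_opX_comm _ _ _

/-- Conjugation of `ρ_{(γ,δ)}` by local operators, for a state invariant under `ρ_β` and `ρ_ε`. -/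
theorem state_rho_add_eq (ω : PositiveFunctional I G) (β γ : I → AddChar G ℂ) (ε δ : I → G)
    (hβ : ∀ A, ω (rhoZ β A) = ω A) (hε : ∀ A, ω (rhoX ε A) = ω A)
    (a : FinChain I (AddChar G ℂ)) (d : FinChain I G) (A : QuasiLocalAlgebra I G) :
    ω (rho (β + (⇑a + γ)) (ε + (⇑d + δ)) A) =
      ω (rho γ δ (opZ a * opX d * A * star (opZ a * opX d))) := by
  have hZX : ∀ (γ : I → AddChar G ℂ) (δ : I → G) A, rhoZ γ (rhoX δ A) = rhoX δ (rhoZ γ A) :=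
    fun γ δ A => DFunLike.congr_fun (rhoZ_comp_rhoX γ δ) A
  have hZ : ∀ (γ γ' : I → AddChar G ℂ) A, rhoZ (γ + γ') A = rhoZ γ (rhoZ γ' A) :=
    fun γ γ' A => DFunLike.congr_fun (rhoZ_add γ γ') A
  have hX : ∀ (δ δ' : I → G) A, rhoX (δ + δ') A = rhoX δ (rhoX δ' A) :=
    fun δ δ' A => DFunLike.congr_fun (rhoX_add δ δ') A
  have hd := isLocalUnitaryRep_opX.apply_eq_conj_of_finChain (isLimitConj_rhoX d) A
  have ha := isLocalUnitaryRep_opZ.apply_eq_conj_of_finChain (isLimitConj_rhoZ a) (rhoX d A)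
  have hconj : opZ a * opX d * A * star (opZ a * opX d) = rhoZ a (rhoX d A) := by
    rw [ha, hd, star_mul]
    simp only [mul_assoc]
  rw [hconj]
  -- The outermost `ρ_β` is absorbed at once; `ρ_ε` is commuted past the `Z` part to become
  -- outermost. Reordering the remaining sums lets the finite parts `a`, `d` act first, as
  -- conjugation by `Z^a X^d`.
  calc ω (rhoZ (β + (⇑a + γ)) (rhoX (ε + (⇑d + δ)) A))
      = ω (rhoZ (⇑a + γ) (rhoX (ε + (⇑d + δ)) A)) := by rw [hZ β, hβ]
    _ = ω (rhoX ε (rhoZ (⇑a + γ) (rhoX (⇑d + δ) A))) := by rw [hX ε, hZX]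
    _ = ω (rhoZ (γ + ⇑a) (rhoX (δ + ⇑d) A)) := by rw [hε, add_comm γ, add_comm δ]
    _ = ω (rhoZ γ (rhoX δ (rhoZ a (rhoX d A)))) := by rw [hZ, hX, hZX a δ]

/-! ### Frustration free ground states and the conclusion. -/

section Model

open Topology

variable {X : Type*} [TopologicalSpace X] [T2Space X] {E : Set X} [CWComplex E]
  {o : Orientation E} {hE : LocallyFinite E o} {n : ℕ}
  {ω : PositiveFunctional (Cell E n) G}

theorem IsFrustrationFreeGroundState.opX_boundaryFin_single
    (hω : IsFrustrationFreeGroundState o hE n ω) (α : lowerCell E n) (g : G) :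
    ω (opX ((lower o hE n).transpose.boundaryFin (Finsupp.single α g))) = 1 :=
  ω.apply_eq_one_of_apply_average_eq_one hω.map_one
    (fun g : G => opX ((lower o hE n).transpose.boundaryFin (Finsupp.single α g)))
    (fun _ => opX_mem_unitary _) (hω.map_starOp α) g

theorem IsFrustrationFreeGroundState.opZ_boundaryFin_single
    (hω : IsFrustrationFreeGroundState o hE n ω) (β : Cell E (n + 1)) (χ : AddChar G ℂ) :
    ω (opZ ((upper o hE n).boundaryFin (Finsupp.single β χ))) = 1 := by
  refine ω.apply_eq_one_of_apply_average_eq_one hω.map_one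
    (fun χ : AddChar G ℂ => opZ ((upper o hE n).boundaryFin (Finsupp.single β χ)))
    (fun _ => opZ_mem_unitary _) ?_ χ
  -- The sum over characters is normalized by `|G|`; it is an average because the dual group has the
  -- same order.
  rw [AddChar.card_eq]
  exact hω.map_plaquetteOp β

end Model

end CellKitaev

theorem proposition7p2 {X : Type*} [TopologicalSpace X] [T2Space X]
    (E : Set X) [Topology.CWComplex E]
    (o : CellKitaev.Orientation E) (hE : CellKitaev.LocallyFinite E o)
    {G : Type*} [AddCommGroup G] [Fintype G] (n : ℕ)
    (ω₀ : CellKitaev.PositiveFunctional (CellKitaev.Cell E n) G)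
    (hω₀ : CellKitaev.IsFrustrationFreeGroundState o hE n ω₀)
    (γ γ' : CellKitaev.Cell E n → AddChar G ℂ)
    (δ δ' : CellKitaev.Cell E n → G)
    (hγ : (CellKitaev.lower o hE n).FiniteBoundary γ)
    (hγ' : (CellKitaev.lower o hE n).FiniteBoundary γ')
    (hδ : (CellKitaev.upper o hE n).transpose.FiniteBoundary δ)
    (hδ' : (CellKitaev.upper o hE n).transpose.FiniteBoundary δ')
    (hγγ' : CellKitaev.Incidence.SameClassAtInfinity
      (CellKitaev.upper o hE n) (CellKitaev.lower o hE n) γ γ' hγ hγ')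
    (hδδ' : CellKitaev.Incidence.SameClassAtInfinity
      (CellKitaev.lower o hE n).transpose (CellKitaev.upper o hE n).transpose δ δ' hδ hδ') :
    CellKitaev.GNSEquivalent
      (CellKitaev.pullback ω₀ (CellKitaev.rho γ δ))
      (CellKitaev.pullback ω₀ (CellKitaev.rho γ' δ')) := by
  obtain ⟨a, c, rfl⟩ := hγγ'.exists_eq_add
  obtain ⟨d, e, rfl⟩ := hδδ'.exists_eq_add
  -- The finite parts `a`, `d` of the two differences supply the intertwining unitary.
  refine CellKitaev.unitarilyEquivalent_gns_of_conj _ _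
    (CellKitaev.opZ a * CellKitaev.opX d)
    (mul_mem (CellKitaev.opZ_mem_unitary a) (CellKitaev.opX_mem_unitary d)) fun A => ?_
  -- The plaquette terms give invariance under `ρ_{∂c}`, the star terms invariance under `ρ_{∂ᵀe}`.
  exact CellKitaev.state_rho_add_eq ω₀ _ γ' _ δ'
    (CellKitaev.isLocalUnitaryRep_opZ.state_apply_boundary_eq _ c
      (CellKitaev.isLimitConj_rhoZ _) ω₀ hω₀.map_one hω₀.opZ_boundaryFin_single)
    (CellKitaev.isLocalUnitaryRep_opX.state_apply_boundary_eq _ e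
      (CellKitaev.isLimitConj_rhoX _) ω₀ hω₀.map_one hω₀.opX_boundaryFin_single) a d A
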